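/- Let $n\in\mathbb N$, $0<\mu$, and let $A\in\mathbb R^{n\times n}$ be symmetric with $\mu I\preceq A\preceq LI$. Put $\kappa=L/\mu$ and let the lower-level objective be $f(x,y)=\tfrac12 y^TAy-y^Tx$ for $x,y\in\mathbb R^n$. Let $F:\mathbb R^n\times\mathbb R^n\to\mathbb R$ be differentiable, with $\nabla_xF$ being $L_{F_x}$-Lipschitz in $y$ and in $x$, $\nabla_yF$ being $L_{F_y}$-Lipschitz in $y$ and $\bar L_{F_y}$-Lipschitz in $x$, and $\|\nabla_yF(x,y)\|\le C_{F_y}$ for all $x,y$. Let $y^*(x)=\arg\min_y f(x,y)$ and $\Phi(x)=F(x,y^*(x))$, and suppose that $\Phi$ is bounded below. *Algorithm (qNBO (BFGS)).* For a pair $(s,g)$ the BFGS update of an inverse Hessian approximation $H$ is $H_+=(I-\rho sg^T)H(I-\rho gs^T)+\rho ss^T$ with $\rho=1/(g^Ts)$ (and $H_+=H$ if $s=0$). Let $H_0=L^{-1}I$, $Q_k=k+1$, and let $\alpha>0$, $T\ge1$, $\xi_{k,i}>0$, $x_0,y_0\in\mathbb R^n$. For $k=0,1,2,\dots$: 1.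 Put $y_{k,0}=y_k$, $H_{k,0}=H_0$. For $t=0,\dots,T-1$ let $y_{k,t+1}=y_{k,t}-H_{k,t}\nabla_yf(x_k,y_{k,t})$, and let $H_{k,t+1}$ be the BFGS update of $H_{k,t}$ with the pair $s=y_{k,t+1}-y_{k,t}$, $g=\nabla_yf(x_k,y_{k,t+1})-\nabla_yf(x_k,y_{k,t})$. Put $y_{k+1}=y_{k,T}$. 2. Let $d=\nabla_yF(x_k,y_{k+1})$. If $Q_k=1$, put $u_{k+1}=H_{k,T}d$. Otherwise let $\tilde H_0=H_0$ and, for $i\ge0$, $u_i=\tilde H_id$, and let $\tilde H_{i+1}$ be the BFGS update of $\tilde H_i$ with the pair $\tilde s_i=\xi_{k,i}u_i$, $\tilde g_i=\nabla_yf(x_k,y_{k+1}+\tilde s_i)-\nabla_yf(x_k,y_{k+1})$; put $u_{k+1}=u_{Q_k-1}$. 3. $x_{k+1}=x_k-\alpha\big(\nabla_xF(x_k,y_{k+1})-[\nabla^2_{xy}f(x_k,y_{k+1})]^Tu_{k+1}\big)$. *Constants.* Let $t_b=4n\ln\kappa$, $c_t=2t_b^{T/2}$, $c_2=L_{F_x}^2+\frac{2L_{F_y}^2}{\mu^2}$,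 $c_1=\frac{6c_2}{\mu^2}$, $L_\Phi=\frac1\mu\big(\bar L_{F_y}+L_{F_x}+\frac{L_{F_y}}{\mu}\big)+L_{F_x}$, and $$\tau=c_t^2\kappa^3\big(\tfrac1T\big)^T\Big((1+\varepsilon)+\big(1+\tfrac1\varepsilon\big)\alpha^2c_1\Big),\quad \omega=c_1\big(1+\tfrac1\varepsilon\big)c_t^2\kappa^3\big(\tfrac1T\big)^T,\quad \delta_0=3c_t^2\kappa^3\big(\tfrac1T\big)^Tc_2\|y^*(x_0)-y_0\|^2 .$$ *Claim.* $\Phi$ is differentiable. There exist $\alpha>0$, $\varepsilon>0$ and an integer $T\ge1$ with $T\ge t_b$ such that $$\tau<1\qquad\text{and}\qquad \alpha L_\Phi+\omega\alpha^2\Big(\frac12+\alpha L_\Phi\Big)\frac1{1-\tau}\le\frac14 .\qquad(*)$$ For all such $\alpha,\varepsilon,T$ satisfying $(*)$, all $x_0,y_0$ and all $\xi_{k,i}>0$, the iterates satisfy, for every $K\ge1$, $$\frac1K\sum_{k=0}^{K-1}\|\nabla\Phi(x_k)\|^2\le\frac{4(\Phi(x_0)-\inf_x\Phi(x))}{\alpha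 K}+\frac{3\delta_0}{K(1-\tau)}+\frac{18nLC_{F_y}^2\ln K}{\mu^3K}.$$ Consequently $\frac1K\sum_{k=0}^{K-1}\|\nabla\Phi(x_k)\|^2=O(\ln K/K)$ as $K\to\infty$. -/

import Mathlib

open scoped Gradient NNReal Matrix

noncomputable section

namespace QNBO

/-- The Euclidean space `ℝⁿ`. -/
abbrev E (n : ℕ) : Type := EuclideanSpace ℝ (Fin n)

/-! ### Partial derivatives of a function of two vector variables -/

/-- `∇ₓ F(x, y)`. -/
def gradX {m n : ℕ} (F : E m → E n → ℝ) (x : E m) (y : E n) : E m :=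
  gradient (fun x' => F x' y) x

/-- `∇_y F(x, y)`. -/
def gradY {m n : ℕ} (F : E m → E n → ℝ) (x : E m) (y : E n) : E n :=
  gradient (fun y' => F x y') y

/-- `∇²ₓ_y f(x, y)`: the Jacobian with respect to `x` of `∇_y f(x, y)`, an `n × m` matrix. -/
def jacXY {m n : ℕ} (f : E m → E n → ℝ) (x : E m) (y : E n) : E m →L[ℝ] E n :=
  fderiv ℝ (fun x' => gradY f x' y) x

/-! ### The bilevel problem -/

/-- `y*(x)`, a minimizer of `f(x, ·)` over `ℝⁿ`. -/
def lowerSol {m n : ℕ} (f : E m → E n → ℝ) (x : E m) : E n :=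
  Classical.epsilon fun y => ∀ z, f x y ≤ f x z

/-- The bilevel objective `Φ(x) = F(x, y*(x))`. -/
def bilevelObj {m n : ℕ} (F f : E m → E n → ℝ) (x : E m) : ℝ :=
  F x (lowerSol f x)

/-! ### BFGS -/

/-- The BFGS update of the inverse Hessian approximation,
`H₊ = (I - ρ s gᵀ) H (I - ρ g sᵀ) + ρ s sᵀ` with `ρ = 1 / (gᵀ s)`.
If `s = 0`, then `ρ = 0` and `H₊ = H`: the update is skipped. -/
def bfgsUpdate {n : ℕ} (H : E n →L[ℝ] E n) (s g : E n) : E n →L[ℝ] E n :=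
  let ρ : ℝ := 1 / inner ℝ g s
  (ContinuousLinearMap.id ℝ (E n) - ρ • InnerProductSpace.rankOne ℝ s g) ∘L H ∘L
      (ContinuousLinearMap.id ℝ (E n) - ρ • InnerProductSpace.rankOne ℝ g s)
    + ρ • InnerProductSpace.rankOne ℝ s s

/-- One quasi-Newton step for `min_y f(x, y)`: from `(y_t, H_t)` to `(y_{t+1}, H_{t+1})`, where
`y_{t+1} = y_t - γ H_t ∇_y f(x, y_t)` and `H_{t+1}` is the BFGS update of `H_t` with the pair
`s_t = y_{t+1} - y_t`, `g_t = ∇_y f(x, y_{t+1}) - ∇_y f(x, y_t)`. -/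
def qnStep {m n : ℕ} (f : E m → E n → ℝ) (γ : ℝ) (x : E m) (p : E n × (E n →L[ℝ] E n)) :
    E n × (E n →L[ℝ] E n) :=
  let y' := p.1 - γ • p.2 (gradY f x p.1)
  (y', bfgsUpdate p.2 (y' - p.1) (gradY f x y' - gradY f x p.1))

/-- Subroutine `𝒜(x, y⁰)`: `P` gradient steps with stepsize `β` followed by `T` quasi-Newton steps
with stepsize `γ` and initial matrix `H₀`. It returns `y_T` together with the matrix `H_T`
that the pairs `(s_t, g_t)`, `t < T`, determine. -/
def subA {m n : ℕ} (f : E m → E n → ℝ) (H₀ : E n →L[ℝ] E n) (β γ : ℝ) (P T : ℕ)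
    (x : E m) (y : E n) : E n × (E n →L[ℝ] E n) :=
  (qnStep f γ x)^[T] ((fun z => z - β • gradY f x z)^[P] y, H₀)

/-- The matrices `H_i` of subroutine `ℬ`: BFGS updates of `H₀` with the pairs
`s_i = ξ_i u_i`, `g_i = ∇_y f(x, y + s_i) - ∇_y f(x, y)`, where `u_i = H_i d`. -/
def matB {m n : ℕ} (f : E m → E n → ℝ) (H₀ : E n →L[ℝ] E n) (ξ : ℕ → ℝ)
    (x : E m) (y d : E n) : ℕ → (E n →L[ℝ] E n)
  | 0 => H₀
  | i + 1 =>
    let H := matB f H₀ ξ x y d i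
    let s := ξ i • H d
    bfgsUpdate H s (gradY f x (y + s) - gradY f x y)

/-- Subroutine `ℬ(x, y, H₀, d, Q)`: it returns `u_{Q-1} = H_{Q-1} d`. -/
def subB {m n : ℕ} (f : E m → E n → ℝ) (H₀ : E n →L[ℝ] E n) (ξ : ℕ → ℝ)
    (x : E m) (y d : E n) (Q : ℕ) : E n :=
  matB f H₀ ξ x y d (Q - 1) d

/-- The iterates `(x_k, y_k)` of qNBO (BFGS). In iteration `k`, `y_{k+1}` comes from subroutine `𝒜`
started at `y_k`; `u_{k+1}` is `H_T ∇_y F(x_k, y_{k+1})` with the matrix `H_T` of subroutine `𝒜` if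
`Q_k = 1`, and the output of subroutine `ℬ` (with its own stepsizes `ξ_{k,i}`) otherwise; and
`x_{k+1} = x_k - α (∇ₓ F(x_k, y_{k+1}) - [∇²ₓ_y f(x_k, y_{k+1})]ᵀ u_{k+1})`. -/
def iter {m n : ℕ} (F f : E m → E n → ℝ) (H₀ : E n →L[ℝ] E n) (α β γ : ℝ) (P T : ℕ)
    (Q : ℕ → ℕ) (ξ : ℕ → ℕ → ℝ) (x₀ : E m) (y₀ : E n) : ℕ → E m × E n
  | 0 => (x₀, y₀)
  | k + 1 =>
    let x := (iter F f H₀ α β γ P T Q ξ x₀ y₀ k).1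
    let a := subA f H₀ β γ P T x (iter F f H₀ α β γ P T Q ξ x₀ y₀ k).2
    let d := gradY F x a.1
    let u := if Q k = 1 then a.2 d else subB f H₀ (ξ k) x a.1 d (Q k)
    (x - α • (gradX F x a.1 - (jacXY f x a.1).adjoint u), a.1)

/-! ### Assumptions and the quadratic lower-level problem -/

/-- Assumptions on the upper-level objective `F`: it is differentiable; `∇ₓ F` is
`LFx`-Lipschitz in `y` and in `x`; `∇_y F` is `LFy`-Lipschitz in `y` and `LFy'`-Lipschitz in `x`;
and `‖∇_y F‖ ≤ CFy`. -/
structure UpperAssumption {m n : ℕ} (F : E m → E n → ℝ) (LFx LFy LFy' : ℝ≥0) (CFy : ℝ) :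
    Prop where
  differentiable : Differentiable ℝ fun p : E m × E n => F p.1 p.2
  gradX_lipschitz_y : ∀ x, LipschitzWith LFx fun y => gradX F x y
  gradX_lipschitz_x : ∀ y, LipschitzWith LFx fun x => gradX F x y
  gradY_lipschitz_y : ∀ x, LipschitzWith LFy fun y => gradY F x y
  gradY_lipschitz_x : ∀ y, LipschitzWith LFy' fun x => gradY F x y
  gradY_bound : ∀ x y, ‖gradY F x y‖ ≤ CFy

/-- `f(x, y) = ½ yᵀ A y - yᵀ x`. -/
def quadLower {n : ℕ} (A : Matrix (Fin n) (Fin n) ℝ) (x y : E n) : ℝ :=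
  1 / 2 * (y.ofLp ⬝ᵥ (A *ᵥ y.ofLp)) - y.ofLp ⬝ᵥ x.ofLp

/-! ### Constants

For the quadratic `f` one has `∇²ₓ_y f = -I` and `∇²_yy f = A`, so the norm bound on `∇²ₓ_y f` is `1`,
all Lipschitz constants of second derivatives are `0`, and `y*` is `1/μ`-Lipschitz. -/

/-- `t_b = 4 n ln κ`, with `κ = L / μ`. -/
def tb (n : ℕ) (μ L : ℝ) : ℝ := 4 * n * Real.log (L / μ)

/-- `c_t = 2 t_b^{T/2}`. -/
def ct (n : ℕ) (μ L : ℝ) (T : ℕ) : ℝ := 2 * tb n μ L ^ ((T : ℝ) / 2)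

/-- `c_t² κ³ (1/T)^T`. -/
def rate (n : ℕ) (μ L : ℝ) (T : ℕ) : ℝ := ct n μ L T ^ 2 * (L / μ) ^ 3 * (1 / (T : ℝ)) ^ T

/-- `c₂ = L_{Fx}² + 2 L_{Fy}² / μ²`. -/
def c₂ (μ LFx LFy : ℝ) : ℝ := LFx ^ 2 + 2 * LFy ^ 2 / μ ^ 2

/-- `c₁ = 6 (1/μ)² c₂`. -/
def c₁ (μ LFx LFy : ℝ) : ℝ := 6 * (1 / μ) ^ 2 * c₂ μ LFx LFy

/-- `τ = c_t² κ³ (1/T)^T ((1 + ε) + (1 + 1/ε) α² c₁)`. -/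
def tau (n : ℕ) (μ L LFx LFy α ε : ℝ) (T : ℕ) : ℝ :=
  rate n μ L T * ((1 + ε) + (1 + 1 / ε) * α ^ 2 * c₁ μ LFx LFy)

/-- `ω = c₁ (1 + 1/ε) c_t² κ³ (1/T)^T`. -/
def omega (n : ℕ) (μ L LFx LFy ε : ℝ) (T : ℕ) : ℝ :=
  c₁ μ LFx LFy * (1 + 1 / ε) * rate n μ L T

/-- The Lipschitz constant of `∇Φ`, `L_Φ = (L̄_{Fy} + C) / μ + L_{Fx}` with
`C = L_{Fx} + L_{Fy} / μ`. -/
def LPhi (μ LFx LFy LFy' : ℝ) : ℝ := (LFy' + (LFx + LFy / μ)) / μ + LFx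

/-- The admissible parameters: `α, ε, T > 0`, `T ≥ t_b`, `τ < 1`, and
`α L_Φ + ω α² (1/2 + α L_Φ) / (1 - τ) ≤ 1/4`. -/
def Admissible (n : ℕ) (μ L LFx LFy LFy' α ε : ℝ) (T : ℕ) : Prop :=
  0 < α ∧ 0 < ε ∧ 0 < T ∧ tb n μ L ≤ T ∧ tau n μ L LFx LFy α ε T < 1 ∧
    α * LPhi μ LFx LFy LFy' +
      omega n μ L LFx LFy ε T * α ^ 2 * (1 / 2 + α * LPhi μ LFx LFy LFy') *
        (1 / (1 - tau n μ L LFx LFy α ε T)) ≤ 1 / 4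

/-- The initial error `δ₀ = 3 c_t² κ³ (1/T)^T c₂ ‖y*(x₀) - y₀‖²`. -/
def delta₀ {n : ℕ} (A : Matrix (Fin n) (Fin n) ℝ) (μ L LFx LFy : ℝ) (T : ℕ) (x₀ y₀ : E n) : ℝ :=
  3 * rate n μ L T * c₂ μ LFx LFy * ‖lowerSol (quadLower A) x₀ - y₀‖ ^ 2

/-- The `x`-iterates of qNBO (BFGS) for the quadratic lower-level problem: no gradient steps
(`P = 0`, so that `β` is immaterial), unit quasi-Newton steps (`γ = 1`), `Q_k = k + 1`, and initial
Hessian approximation `L I`, that is, initial inverse Hessian approximation `H₀ = L⁻¹ I`. -/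
def xIter {n : ℕ} (F : E n → E n → ℝ) (A : Matrix (Fin n) (Fin n) ℝ) (L α β : ℝ) (T : ℕ)
    (ξ : ℕ → ℕ → ℝ) (x₀ y₀ : E n) (k : ℕ) : E n :=
  (iter F (quadLower A) (L⁻¹ • ContinuousLinearMap.id ℝ (E n)) α β 1 0 T (fun j => j + 1) ξ
    x₀ y₀ k).1

end QNBO

end

/-!
With `S` the symmetric square root of `A` and `K = S H S`, the BFGS update of `H` along `s` becomes
`K₊ = (I - P) K (I - P) + P`, where `P` is the orthogonal projection onto the span of `S s`. It
keeps `K` symmetric with spectrum in `[m, 1]`, `m = μ / L = 1 / κ`.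

In the quasi-Newton iteration for `y*(x)`, the error `z = S (y - y*)` obeys `z₊ = z - K z` and the
update is along `K z`. Let `1 + q = ⟨K z, z⟩ / ‖K z‖² ≥ 1`. The update multiplies `det K` by `1 + q`
(`IsBetween.det_bfgsUpdate`), so `∏ (1 + q_t) ≤ κ ^ n`, and the energy `⟨K z, z⟩` contracts by `2 q`
(`IsBetween.energy_step`). Under the first constraint the product of the `q_t` is largest when they
are equal, which gives the superlinear rate `(4 n ln κ / T) ^ T`
(`IsBetween.norm_newtonSeq_sq_le`).

In the iteration for `A⁻¹ d`, the updates are along `K_i v` with a fixed `v`. The trace of `K_i⁻¹`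
drops by at least `‖v - K_i v‖² / ‖v‖²` per step, starts at no more than `n κ` and stays at least `n`;
as the residuals are nonincreasing, the one after `k` updates is `O(1 / (k + 1))`
(`IsBetween.norm_residual_fixedSeq_sq_le`).

The outer iteration is inexact gradient descent on `Φ`, whose gradient is `L_Φ`-Lipschitz
(`norm_hyperGrad_sub_le`). Its squared errors split into a part caused by `y`, which satisfies a
linear recursion with factor `τ`, and three times the squared error `h_k` of the linear solve;
summation (`sum_grad_le_of_recursion`) leaves `9 ∑ h_k`, where `h_k ≤ U / (k + 1)` for `k ≥ 1` with
`U = n L C² / μ³`. The matrix used for `k = 0` does not come from the second subroutine, but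
`spec K ⊆ [m, 1]` alone gives `h_0 ≤ U / 4`. So `9 ∑ h_k ≤ 9 U (1/4 + ln K) ≤ 18 U ln K` as soon as
`K ≥ 2`. For `K = 1`, where `ln K = 0`, the claim follows from one exact gradient step
and the boundedness of `Φ` from below.
-/

namespace QNBO

open Finset

/-! ### The BFGS update in normalized coordinates -/

/-- The component of `x` orthogonal to `u`. For `u = 0` it is `x` itself. -/
noncomputable def orthPart {n : ℕ} (u x : E n) : E n := x - (inner ℝ u x / ‖u‖ ^ 2) • u

theorem inner_orthPart {n : ℕ} (u x : E n) : inner ℝ u (orthPart u x) = 0 := by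
  rcases eq_or_ne u 0 with rfl | hu
  · simp
  · have : ‖u‖ ≠ 0 := norm_ne_zero_iff.2 hu
    rw [orthPart, inner_sub_right, inner_smul_right, real_inner_self_eq_norm_sq]
    field_simp
    ring

theorem norm_sq_eq_orthPart {n : ℕ} (u x : E n) :
    ‖x‖ ^ 2 = ‖orthPart u x‖ ^ 2 + inner ℝ u x ^ 2 / ‖u‖ ^ 2 := by
  have hx : x = orthPart u x + (inner ℝ u x / ‖u‖ ^ 2) • u := by simp [orthPart]
  have h := norm_add_sq_real (orthPart u x) ((inner ℝ u x / ‖u‖ ^ 2) • u)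
  rw [← hx, inner_smul_right, real_inner_comm u (orthPart u x), inner_orthPart, norm_smul, mul_pow,
    Real.norm_eq_abs, sq_abs] at h
  rw [h]
  rcases eq_or_ne u 0 with rfl | hu
  · simp
  · have : ‖u‖ ≠ 0 := norm_ne_zero_iff.2 hu
    field_simp
    ring

theorem norm_orthPart_le {n : ℕ} (u x : E n) : ‖orthPart u x‖ ≤ ‖x‖ := by
  have := norm_sq_eq_orthPart u x
  refine abs_le_of_sq_le_sq' ?_ (norm_nonneg _) |>.2
  have : 0 ≤ inner ℝ u x ^ 2 / ‖u‖ ^ 2 := by positivity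
  linarith

theorem orthPart_add_smul {n : ℕ} (u x : E n) (c : ℝ) : orthPart u (x + c • u) = orthPart u x := by
  rcases eq_or_ne u 0 with rfl | hu
  · simp
  · have : ‖u‖ ≠ 0 := norm_ne_zero_iff.2 hu
    simp only [orthPart, inner_add_right, inner_smul_right, real_inner_self_eq_norm_sq]
    rw [add_div, mul_div_cancel_right₀ _ (by positivity), add_smul]
    abel

theorem inner_orthPart_left {n : ℕ} (u x y : E n) :
    inner ℝ (orthPart u x) y = inner ℝ x (orthPart u y) := by
  simp only [orthPart, inner_sub_left, inner_sub_right, inner_smul_left, inner_smul_right,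
    RCLike.conj_to_real]
  rw [real_inner_comm x u]
  ring

/-- With the pair `(u, u)` the BFGS update is `(I - P) K (I - P) + P`, where `P` is the orthogonal
projection onto the span of `u`. -/
theorem bfgsUpdate_self_apply {n : ℕ} (K : E n →L[ℝ] E n) (u x : E n) :
    bfgsUpdate K u u x = orthPart u (K (orthPart u x)) + (inner ℝ u x / ‖u‖ ^ 2) • u := by
  simp only [bfgsUpdate, orthPart, _root_.add_apply, ContinuousLinearMap.comp_apply,
    _root_.sub_apply, _root_.smul_apply, ContinuousLinearMap.id_apply,
    InnerProductSpace.rankOne_apply, real_inner_self_eq_norm_sq, smul_smul]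
  simp only [one_div, inv_mul_eq_div]

theorem bfgsUpdate_smul_self {n : ℕ} (K : E n →L[ℝ] E n) (u : E n) {c : ℝ} (hc : c ≠ 0) :
    bfgsUpdate K (c • u) (c • u) = bfgsUpdate K u u := by
  have key : ∀ x : E n, (inner ℝ (c • u) x / ‖c • u‖ ^ 2) • (c • u)
      = (inner ℝ u x / ‖u‖ ^ 2) • u := by
    intro x
    rcases eq_or_ne u 0 with rfl | hu
    · simp
    have : ‖u‖ ≠ 0 := norm_ne_zero_iff.2 hu
    rw [norm_smul, mul_pow, Real.norm_eq_abs, sq_abs, inner_smul_left, smul_smul]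
    congr 1
    simp only [RCLike.conj_to_real]
    field_simp
  ext1 x
  simp only [bfgsUpdate_self_apply, orthPart, key]

/-- BFGS commutes with a symmetric change of variables: with `A = S²`, the matrices `S H S` are
updated by the pair `(S s, S s)`. -/
theorem bfgsUpdate_conj {n : ℕ} (H S A : E n →L[ℝ] E n)
    (hS : ∀ x y, inner ℝ (S x) y = inner ℝ x (S y)) (hA : S ∘L S = A) (s : E n) :
    S ∘L bfgsUpdate H s (A s) ∘L S = bfgsUpdate (S ∘L H ∘L S) (S s) (S s) := by
  have hA' : ∀ x, A x = S (S x) := fun x => by rw [← hA]; rfl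
  ext1 x
  simp only [bfgsUpdate, _root_.add_apply, ContinuousLinearMap.comp_apply,
    _root_.sub_apply, _root_.smul_apply, ContinuousLinearMap.id_apply,
    InnerProductSpace.rankOne_apply, hA', map_add, map_sub, map_smul, hS]

/-- `K` is symmetric with spectrum in `[m, 1]`. -/
structure IsBetween {n : ℕ} (m : ℝ) (K : E n →L[ℝ] E n) : Prop where
  symm : ∀ x y, inner ℝ (K x) y = inner ℝ x (K y)
  lower : ∀ x, m * ‖x‖ ^ 2 ≤ inner ℝ (K x) x
  upper : ∀ x, inner ℝ (K x) x ≤ ‖x‖ ^ 2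

/-- Cauchy–Schwarz for a positive semidefinite form. -/
theorem inner_sq_le_of_nonneg {n : ℕ} (K : E n →L[ℝ] E n)
    (hs : ∀ x y, inner ℝ (K x) y = inner ℝ x (K y)) (h0 : ∀ x, 0 ≤ inner ℝ (K x) x) (x y : E n) :
    inner ℝ (K x) y ^ 2 ≤ inner ℝ (K x) x * inner ℝ (K y) y := by
  have h : ∀ t : ℝ, 0 ≤ inner ℝ (K y) y * (t * t) + (2 * inner ℝ (K x) y) * t
      + inner ℝ (K x) x := by
    intro t
    have := h0 (x + t • y)
    simp only [map_add, map_smul, inner_add_left, inner_add_right, inner_smul_left,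
      inner_smul_right, RCLike.conj_to_real] at this
    rw [hs y x, real_inner_comm (K x) y] at this
    linarith
  have := discrim_le_zero h
  rw [discrim] at this
  linarith

/-- A positive semidefinite `K ≤ I` satisfies `K² ≤ K`. -/
theorem norm_sq_apply_le_inner {n : ℕ} (K : E n →L[ℝ] E n)
    (hs : ∀ x y, inner ℝ (K x) y = inner ℝ x (K y)) (h0 : ∀ x, 0 ≤ inner ℝ (K x) x)
    (h1 : ∀ x, inner ℝ (K x) x ≤ ‖x‖ ^ 2) (x : E n) : ‖K x‖ ^ 2 ≤ inner ℝ (K x) x := by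
  have h := inner_sq_le_of_nonneg K hs h0 x (K x)
  rw [real_inner_self_eq_norm_sq] at h
  have h2 := mul_le_mul_of_nonneg_left (h1 (K x)) (h0 x)
  rcases eq_or_ne (K x) 0 with hz | hz
  · simp [hz]
  · have : 0 < ‖K x‖ ^ 2 := by positivity
    nlinarith

namespace IsBetween

variable {n : ℕ} {m : ℝ} {K : E n →L[ℝ] E n}

theorem norm_sq_le (h : IsBetween m K) (hm : 0 ≤ m) (x : E n) :
    ‖K x‖ ^ 2 ≤ inner ℝ (K x) x :=
  norm_sq_apply_le_inner K h.symm (fun x => le_trans (by positivity) (h.lower x)) h.upper x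

theorem one_sub_inner (K : E n →L[ℝ] E n) (x : E n) :
    inner ℝ ((ContinuousLinearMap.id ℝ (E n) - K) x) x = ‖x‖ ^ 2 - inner ℝ (K x) x := by
  simp [inner_sub_left]

theorem norm_sub_sq_le (h : IsBetween m K) (hm : 0 ≤ m) (x : E n) :
    ‖x - K x‖ ^ 2 ≤ ‖x‖ ^ 2 - inner ℝ (K x) x := by
  have := norm_sq_apply_le_inner (ContinuousLinearMap.id ℝ (E n) - K)
    (fun x y => by simp [inner_sub_left, inner_sub_right, h.symm])
    (fun x => by rw [one_sub_inner]; linarith [h.upper x])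
    (fun x => by
      rw [one_sub_inner]
      have : 0 ≤ m * ‖x‖ ^ 2 := by positivity
      linarith [h.lower x]) x
  rw [one_sub_inner] at this
  simpa using this

theorem norm_sub_le (h : IsBetween m K) (hm : 0 ≤ m) (x : E n) : ‖x - K x‖ ≤ ‖x‖ := by
  have h1 := h.norm_sub_sq_le hm x
  have h2 := h.lower x
  have : 0 ≤ m * ‖x‖ ^ 2 := by positivity
  exact (abs_le_of_sq_le_sq' (by linarith) (norm_nonneg _)).2

theorem inner_pos (h : IsBetween m K) (hm : 0 < m) {x : E n} (hx : x ≠ 0) :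
    0 < inner ℝ (K x) x :=
  lt_of_lt_of_le (by positivity) (h.lower x)

theorem apply_ne_zero (h : IsBetween m K) (hm : 0 < m) {x : E n} (hx : x ≠ 0) : K x ≠ 0 := by
  intro h0
  have := h.inner_pos hm hx
  simp [h0] at this

end IsBetween

theorem inner_bfgsUpdate_self {n : ℕ} (K : E n →L[ℝ] E n) (u x : E n) :
    inner ℝ (bfgsUpdate K u u x) x
      = inner ℝ (K (orthPart u x)) (orthPart u x) + inner ℝ u x ^ 2 / ‖u‖ ^ 2 := by
  rw [bfgsUpdate_self_apply, inner_add_left, inner_orthPart_left, inner_smul_left]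
  simp only [RCLike.conj_to_real]
  ring

theorem IsBetween.bfgsUpdate {n : ℕ} {m : ℝ} {K : E n →L[ℝ] E n} (h : IsBetween m K) (hm : m ≤ 1)
    (u : E n) : IsBetween m (bfgsUpdate K u u) where
  symm x y := by
    rw [bfgsUpdate_self_apply, bfgsUpdate_self_apply, inner_add_left, inner_orthPart_left, h.symm,
      inner_add_right, inner_smul_left, inner_smul_right, ← inner_orthPart_left u x,
      real_inner_comm u x]
    simp only [RCLike.conj_to_real]
    ring
  lower x := by
    rw [inner_bfgsUpdate_self, norm_sq_eq_orthPart u x]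
    have h1 := h.lower (orthPart u x)
    have : 0 ≤ inner ℝ u x ^ 2 / ‖u‖ ^ 2 := by positivity
    nlinarith
  upper x := by
    rw [inner_bfgsUpdate_self, norm_sq_eq_orthPart u x]
    have h1 := h.upper (orthPart u x)
    linarith

/-! ### A fixed right-hand side: the residual decreases like `1 / k` -/

/-- BFGS updates along the directions `K_i d`. -/
noncomputable def fixedSeq {n : ℕ} (K : E n →L[ℝ] E n) (d : E n) : ℕ → (E n →L[ℝ] E n)
  | 0 => K
  | i + 1 => bfgsUpdate (fixedSeq K d i) (fixedSeq K d i d) (fixedSeq K d i d)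

theorem IsBetween.fixedSeq {n : ℕ} {m : ℝ} {K : E n →L[ℝ] E n} (h : IsBetween m K) (hm : m ≤ 1)
    (d : E n) (i : ℕ) : IsBetween m (fixedSeq K d i) := by
  induction i with
  | zero => exact h
  | succ i ih => exact ih.bfgsUpdate hm _

/-- With `P` the projection onto the span of `u = K d`, the new residual of `d` is
`(I - P) (I - K) (I - P) (d - K d)`. -/
theorem IsBetween.norm_residual_bfgsUpdate_le {n : ℕ} {m : ℝ} {K : E n →L[ℝ] E n}
    (h : IsBetween m K) (hm : 0 ≤ m) (d : E n) :
    ‖d - QNBO.bfgsUpdate K (K d) (K d) d‖ ≤ ‖d - K d‖ := by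
  set u := K d with hu
  have h1 : d - QNBO.bfgsUpdate K u u d
      = orthPart u (orthPart u d - K (orthPart u d)) := by
    have h2 : orthPart u (orthPart u d) = orthPart u d := by
      conv_lhs => rw [orthPart, inner_orthPart]
      simp
    have h3 : ∀ a b : E n, orthPart u (a - b) = orthPart u a - orthPart u b := by
      intro a b
      simp only [orthPart, inner_sub_right, sub_div, sub_smul]
      abel
    have h5 : d - (inner ℝ u d / ‖u‖ ^ 2) • u = orthPart u d := rfl
    rw [bfgsUpdate_self_apply, h3, h2, ← h5]
    abel
  rw [h1]
  have h4 : orthPart u d = orthPart u (d - u) := by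
    have := orthPart_add_smul u d (-1)
    rw [← this]
    congr 1
    simp [sub_eq_add_neg]
  calc _ ≤ ‖orthPart u d - K (orthPart u d)‖ := norm_orthPart_le _ _
    _ ≤ ‖orthPart u d‖ := h.norm_sub_le hm _
    _ ≤ _ := by rw [h4]; exact norm_orthPart_le _ _

/-- The inverse of the updated matrix is `B - d dᵀ / ⟨K d, d⟩ + P`, where `B = K⁻¹` and `P` is the
projection onto the span of `K d`. -/
theorem IsBetween.exists_inverse_bfgsUpdate {n : ℕ} {m : ℝ} {K : E n →L[ℝ] E n}
    (h : IsBetween m K) (hm : 0 < m) {d : E n} (hd : d ≠ 0) (B : E n →ₗ[ℝ] E n)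
    (hB : B ∘ₗ (K : E n →ₗ[ℝ] E n) = LinearMap.id) :
    ∃ B' : E n →ₗ[ℝ] E n,
      B' ∘ₗ (QNBO.bfgsUpdate K (K d) (K d) : E n →ₗ[ℝ] E n) = LinearMap.id ∧
      LinearMap.trace ℝ (E n) B' = LinearMap.trace ℝ (E n) B + 1 - ‖d‖ ^ 2 / inner ℝ (K d) d := by
  have hu := h.apply_ne_zero hm hd
  have hud := h.inner_pos hm hd
  have hBK : ∀ x, B (K x) = x := fun x => LinearMap.congr_fun hB x
  set u := K d with hudef
  have hN : ‖u‖ ≠ 0 := norm_ne_zero_iff.2 hu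
  refine ⟨B - (1 / inner ℝ u d) • (InnerProductSpace.rankOne ℝ d d : E n →ₗ[ℝ] E n)
    + (1 / ‖u‖ ^ 2) • (InnerProductSpace.rankOne ℝ u u : E n →ₗ[ℝ] E n), ?_, ?_⟩
  · ext1 x
    have hw := inner_orthPart u x
    have hx : x = orthPart u x + (inner ℝ u x / ‖u‖ ^ 2) • u := by simp [orthPart]
    set w := orthPart u x with hwdef
    have hdw : inner ℝ d (K w) = 0 := by rw [← h.symm, ← hudef, hw]
    have hBu : B u = d := hBK d
    simp only [LinearMap.comp_apply, LinearMap.add_apply, LinearMap.sub_apply, LinearMap.smul_apply,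
      ContinuousLinearMap.coe_coe, InnerProductSpace.rankOne_apply, LinearMap.id_apply,
      bfgsUpdate_self_apply]
    rw [← hwdef]
    simp only [map_add, inner_add_right, inner_orthPart, map_smul, inner_smul_right, hBu]
    rw [show inner ℝ d (orthPart u (K w)) = -(inner ℝ u (K w) / ‖u‖ ^ 2) * inner ℝ u d by
        rw [orthPart, inner_sub_right, inner_smul_right, hdw, real_inner_comm u d]; ring,
      show B (orthPart u (K w)) = w - (inner ℝ u (K w) / ‖u‖ ^ 2) • d by
        rw [orthPart, map_sub, map_smul, hBK, hBu], real_inner_comm u d,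
        real_inner_self_eq_norm_sq]
    conv_rhs => rw [hx]
    match_scalars <;> field_simp <;> ring
  · simp only [map_add, map_sub, map_smul, InnerProductSpace.trace_rankOne,
      real_inner_self_eq_norm_sq, smul_eq_mul]
    field_simp
    ring

/-- If `K ≤ I` then `tr K⁻¹ ≥ n`. -/
theorem IsBetween.le_trace_inverse {n : ℕ} {m : ℝ} {K : E n →L[ℝ] E n}
    (h : IsBetween m K) (hm : 0 < m) (B : E n →ₗ[ℝ] E n)
    (hB : B ∘ₗ (K : E n →ₗ[ℝ] E n) = LinearMap.id) : n ≤ LinearMap.trace ℝ (E n) B := by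
  have hKB : ∀ x, K (B x) = x := fun x =>
    LinearMap.congr_fun (mul_eq_one_comm.1 hB : (K : E n →ₗ[ℝ] E n) * B = 1) x
  have hb : ∀ x, ‖x‖ ^ 2 ≤ inner ℝ x (B x) := fun x => by
    have := h.norm_sq_le hm.le (B x)
    rwa [hKB] at this
  rw [LinearMap.trace_eq_sum_inner B (EuclideanSpace.basisFun (Fin n) ℝ)]
  calc (n : ℝ) = ∑ i : Fin n, (1 : ℝ) := by simp
    _ ≤ _ := Finset.sum_le_sum fun i _ => by
      have := hb (EuclideanSpace.basisFun (Fin n) ℝ i)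
      simpa using this

/-- If `K ≥ m I` then `tr K⁻¹ ≤ n / m`. -/
theorem IsBetween.exists_inverse {n : ℕ} {m : ℝ} {K : E n →L[ℝ] E n}
    (h : IsBetween m K) (hm : 0 < m) : ∃ B : E n →ₗ[ℝ] E n,
      B ∘ₗ (K : E n →ₗ[ℝ] E n) = LinearMap.id ∧ LinearMap.trace ℝ (E n) B ≤ n / m := by
  have hinj : LinearMap.ker (K : E n →ₗ[ℝ] E n) = ⊥ := by
    rw [LinearMap.ker_eq_bot']
    intro x hx
    by_contra h0
    exact h.apply_ne_zero hm h0 hx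
  obtain ⟨B, hB⟩ := LinearMap.exists_leftInverse_of_injective _ hinj
  refine ⟨B, hB, ?_⟩
  have hKB : ∀ x, K (B x) = x := fun x =>
    LinearMap.congr_fun (mul_eq_one_comm.1 hB : (K : E n →ₗ[ℝ] E n) * B = 1) x
  have hb : ∀ x, inner ℝ x (B x) ≤ ‖x‖ ^ 2 / m := fun x => by
    have h1 := h.lower (B x)
    rw [hKB] at h1
    have h2 := real_inner_le_norm x (B x)
    have h3 : m * ‖B x‖ ≤ ‖x‖ := by
      rcases eq_or_ne (B x) 0 with h0 | h0
      · simp [h0]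
      · have : 0 < ‖B x‖ := norm_pos_iff.2 h0
        nlinarith
    rw [le_div_iff₀ hm]
    nlinarith [norm_nonneg x, norm_nonneg (B x)]
  rw [LinearMap.trace_eq_sum_inner B (EuclideanSpace.basisFun (Fin n) ℝ)]
  calc _ ≤ ∑ i : Fin n, 1 / m := Finset.sum_le_sum fun i _ => by
        have := hb (EuclideanSpace.basisFun (Fin n) ℝ i)
        simpa using this
    _ = _ := by simp [div_eq_mul_inv]

/-- The trace of the inverse drops by `(‖d‖² - ⟨K_i d, d⟩) / ⟨K_i d, d⟩` in each step, which
dominates the relative squared residual `‖d - K_i d‖² / ‖d‖²`. -/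
theorem IsBetween.sum_norm_residual_le {n : ℕ} {m : ℝ} {K : E n →L[ℝ] E n}
    (h : IsBetween m K) (hm : 0 < m) (hm1 : m ≤ 1) (d : E n) (k : ℕ) :
    ∑ i ∈ range k, ‖d - QNBO.fixedSeq K d i d‖ ^ 2 ≤ n * (1 / m - 1) * ‖d‖ ^ 2 := by
  rcases eq_or_ne d 0 with rfl | hd
  · simp
  have hdpos : 0 < ‖d‖ ^ 2 := by positivity
  have key : ∀ k : ℕ, ∃ B : E n →ₗ[ℝ] E n,
      B ∘ₗ (QNBO.fixedSeq K d k : E n →ₗ[ℝ] E n) = LinearMap.id ∧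
      LinearMap.trace ℝ (E n) B + ∑ i ∈ range k, ‖d - QNBO.fixedSeq K d i d‖ ^ 2 / ‖d‖ ^ 2
        ≤ n / m := by
    intro k
    induction k with
    | zero => simpa [QNBO.fixedSeq] using h.exists_inverse hm
    | succ k ih =>
      obtain ⟨B, hB, hk⟩ := ih
      have hK := h.fixedSeq hm1 d k
      obtain ⟨B', hB', ht⟩ := hK.exists_inverse_bfgsUpdate hm hd B hB
      refine ⟨B', hB', ?_⟩
      rw [ht, sum_range_succ]
      have h1 := hK.norm_sub_sq_le hm.le d
      have h2 := hK.upper d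
      have h3 := hK.inner_pos hm hd
      have h4 : ‖d - QNBO.fixedSeq K d k d‖ ^ 2 / ‖d‖ ^ 2
          ≤ ‖d‖ ^ 2 / inner ℝ (QNBO.fixedSeq K d k d) d - 1 := by
        rw [div_sub_one h3.ne']
        exact (div_le_div_of_nonneg_right h1 hdpos.le).trans
          (div_le_div_of_nonneg_left (by linarith) h3 h2)
      linarith
  obtain ⟨B, hB, hk⟩ := key k
  have h1 := (h.fixedSeq hm1 d k).le_trace_inverse hm B hB
  rw [← sum_div] at hk
  have h2 : (∑ i ∈ range k, ‖d - QNBO.fixedSeq K d i d‖ ^ 2) / ‖d‖ ^ 2 ≤ n * (1 / m - 1) := by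
    have : (n : ℝ) * (1 / m - 1) = n / m - n := by ring
    linarith
  rwa [div_le_iff₀ hdpos] at h2

/-- The residuals are nonincreasing, so the last one is at most the average. -/
theorem IsBetween.norm_residual_fixedSeq_sq_le {n : ℕ} {m : ℝ} {K : E n →L[ℝ] E n}
    (h : IsBetween m K) (hm : 0 < m) (hm1 : m ≤ 1) (d : E n) (k : ℕ) :
    ‖d - QNBO.fixedSeq K d k d‖ ^ 2 ≤ n * (1 / m - 1) * ‖d‖ ^ 2 / (k + 1) := by
  have hanti : Antitone fun i => ‖d - QNBO.fixedSeq K d i d‖ :=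
    antitone_nat_of_succ_le fun i => (h.fixedSeq hm1 d i).norm_residual_bfgsUpdate_le hm.le d
  have h1 := h.sum_norm_residual_le hm hm1 d (k + 1)
  have h2 : ∑ i ∈ range (k + 1), ‖d - QNBO.fixedSeq K d k d‖ ^ 2
      ≤ ∑ i ∈ range (k + 1), ‖d - QNBO.fixedSeq K d i d‖ ^ 2 :=
    sum_le_sum fun i hi => by
      have : ‖d - QNBO.fixedSeq K d k d‖ ≤ ‖d - QNBO.fixedSeq K d i d‖ :=
        hanti (Nat.lt_succ_iff.1 (mem_range.1 hi))
      gcongr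
  rw [le_div_iff₀ (by positivity)]
  simp only [sum_const, card_range, nsmul_eq_mul, Nat.cast_add, Nat.cast_one] at h2
  linarith

/-! ### Superlinear convergence of BFGS on a quadratic -/

theorem IsBetween.det_mem_Icc {n : ℕ} {m : ℝ} {K : E n →L[ℝ] E n} (h : IsBetween m K)
    (hm : 0 ≤ m) : LinearMap.det (K : E n →ₗ[ℝ] E n) ∈ Set.Icc (m ^ n) 1 := by
  have hs : (K : E n →ₗ[ℝ] E n).IsSymmetric := fun x y => h.symm x y
  have hn : Module.finrank ℝ (E n) = n := by simp
  have hev : ∀ i, inner ℝ (K (hs.eigenvectorBasis hn i)) (hs.eigenvectorBasis hn i)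
      = hs.eigenvalues hn i := by
    intro i
    have := hs.apply_eigenvectorBasis hn i
    rw [ContinuousLinearMap.coe_coe] at this
    rw [this, inner_smul_left]
    simp
  have h1 : ∀ i, ‖hs.eigenvectorBasis hn i‖ ^ 2 = 1 := by simp
  rw [hs.det_eq_prod_eigenvalues hn]
  constructor
  · calc m ^ n = ∏ i : Fin n, m := by simp
      _ ≤ _ := prod_le_prod (fun _ _ => hm) fun i _ => by
        have := h.lower (hs.eigenvectorBasis hn i)
        rw [hev, h1] at this
        simpa using this
  · refine prod_le_one (fun i _ => ?_) fun i _ => ?_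
    · have := h.lower (hs.eigenvectorBasis hn i)
      rw [hev, h1] at this
      simp only [RCLike.ofReal_real_eq_id, id]
      linarith
    · have := h.upper (hs.eigenvectorBasis hn i)
      rw [hev, h1] at this
      simpa using this

/-- The updated matrix is `W K Wᵀ` with `W` a rank-one perturbation of the identity, so the
determinant is multiplied by `⟨K z, z⟩ / ‖K z‖²`. -/
theorem IsBetween.det_bfgsUpdate {n : ℕ} {m : ℝ} {K : E n →L[ℝ] E n} (h : IsBetween m K)
    (hm : 0 < m) {z : E n} (hz : z ≠ 0) :
    LinearMap.det (QNBO.bfgsUpdate K (K z) (K z) : E n →ₗ[ℝ] E n)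
      = inner ℝ (K z) z / ‖K z‖ ^ 2 * LinearMap.det (K : E n →ₗ[ℝ] E n) := by
  have hu := h.apply_ne_zero hm hz
  have hE := h.inner_pos hm hz
  set u := K z with hudef
  have hN : ‖u‖ ≠ 0 := norm_ne_zero_iff.2 hu
  set r := Real.sqrt (inner ℝ u z) with hr
  have hr2 : r ^ 2 = inner ℝ u z := Real.sq_sqrt hE.le
  have hr0 : r ≠ 0 := (Real.sqrt_pos.2 hE).ne'
  -- `W = I + u aᵀ`, that is, `W = I - P + u zᵀ / (‖u‖ r)` with `r = √⟨K z, z⟩`.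
  set a : E n := (1 / (‖u‖ * r)) • z - (1 / ‖u‖ ^ 2) • u with ha
  have hdet : inner ℝ a u = r / ‖u‖ - 1 := by
    rw [ha, inner_sub_left, inner_smul_left, inner_smul_left, real_inner_self_eq_norm_sq,
      real_inner_comm u z, ← hr2]
    simp only [RCLike.conj_to_real]
    field_simp
  have hfac : (QNBO.bfgsUpdate K u u : E n →ₗ[ℝ] E n)
      = LinearMap.transvection (innerₛₗ ℝ a) u ∘ₗ (K : E n →ₗ[ℝ] E n) ∘ₗ
        LinearMap.transvection (innerₛₗ ℝ u) a := by
    ext1 x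
    have hx : x + inner ℝ u x • a = orthPart u x + (inner ℝ u x / (‖u‖ * r)) • z := by
      rw [ha, orthPart]
      module
    simp only [LinearMap.comp_apply, LinearMap.transvection.apply, ContinuousLinearMap.coe_coe,
      innerₛₗ_apply_apply, bfgsUpdate_self_apply]
    rw [hx, map_add, map_smul, ← hudef]
    have hw : inner ℝ z (K (orthPart u x)) = 0 := by
      rw [← h.symm, ← hudef, inner_orthPart]
    rw [inner_add_right, inner_smul_right, hdet,
      show inner ℝ a (K (orthPart u x)) = -(inner ℝ u (K (orthPart u x)) / ‖u‖ ^ 2) by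
        rw [ha, inner_sub_left, inner_smul_left, inner_smul_left, hw]
        simp only [RCLike.conj_to_real]
        ring]
    rw [show orthPart u (K (orthPart u x)) = K (orthPart u x)
      - (inner ℝ u (K (orthPart u x)) / ‖u‖ ^ 2) • u from rfl]
    match_scalars <;> field_simp
    ring
  rw [hfac, LinearMap.det_comp, LinearMap.det_comp, LinearMap.transvection.det,
    LinearMap.transvection.det]
  simp only [innerₛₗ_apply_apply]
  rw [real_inner_comm a u, hdet, ← hr2]
  field_simp
  ring

/-- With `q = ⟨K z, z⟩ / ‖K z‖² - 1`, the energy `⟨K z, z⟩` decreases by the factor `2 q`. -/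
theorem IsBetween.energy_step {n : ℕ} {m : ℝ} {K : E n →L[ℝ] E n} (h : IsBetween m K)
    (hm : 0 < m) {z : E n} (hz : z ≠ 0) :
    inner ℝ (QNBO.bfgsUpdate K (K z) (K z) (z - K z)) (z - K z)
      ≤ 2 * (inner ℝ (K z) z / ‖K z‖ ^ 2 - 1) * inner ℝ (K z) z := by
  have hu := h.apply_ne_zero hm hz
  have hE := h.inner_pos hm hz
  have hq := h.norm_sq_le hm.le z
  set u := K z with hudef
  have hN : 0 < ‖u‖ ^ 2 := by positivity
  have hN' : ‖u‖ ≠ 0 := norm_ne_zero_iff.2 hu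
  set p := inner ℝ u z / ‖u‖ ^ 2 with hp
  have hEp : inner ℝ u z = p * ‖u‖ ^ 2 := by rw [hp]; field_simp
  have hp1 : 1 ≤ p := by rw [hp, one_le_div hN]; exact hq
  have hw : orthPart u (z - u) = z - p • u := by
    rw [orthPart, inner_sub_right, real_inner_self_eq_norm_sq, hEp]
    match_scalars
    · simp
    · field_simp
      ring
  have hG := h.upper u
  have hKu : inner ℝ (K u) z = ‖u‖ ^ 2 := by
    rw [h.symm, ← hudef, real_inner_self_eq_norm_sq]
  rw [inner_bfgsUpdate_self, hw, map_sub, map_smul, ← hudef]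
  simp only [inner_sub_left, inner_sub_right, inner_smul_left, inner_smul_right,
    RCLike.conj_to_real, real_inner_self_eq_norm_sq, hKu]
  rw [hEp]
  have h1 : (p * ‖u‖ ^ 2 - ‖u‖ ^ 2) ^ 2 / ‖u‖ ^ 2 = (p - 1) ^ 2 * ‖u‖ ^ 2 := by
    field_simp
  rw [h1]
  have h2 : p * (p * inner ℝ (K u) u) ≤ p * (p * ‖u‖ ^ 2) := by
    have : 0 ≤ p := by linarith
    gcongr
  nlinarith [mul_nonneg (sub_nonneg.2 hp1) hN.le]

/-- Among sequences with `∏ (1 + q_i)` bounded by `(1 + a)^T`, the product `∏ q_i` is largest when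
all `q_i` equal `a`. -/
theorem prod_le_pow_of_prod_one_add_le (q : ℕ → ℝ) (hq : ∀ i, 0 ≤ q i) (T : ℕ) (hT : 0 < T)
    (a : ℝ) (ha : 0 ≤ a) (h : ∏ i ∈ range T, (1 + q i) ≤ (1 + a) ^ T) :
    ∏ i ∈ range T, q i ≤ a ^ T := by
  rcases ha.eq_or_lt with rfl | ha
  · have h0 : ∀ i ∈ range T, q i = 0 := by
      intro i hi
      have h1 : 1 + q i ≤ ∏ i ∈ range T, (1 + q i) := by
        rw [← mul_prod_erase _ _ hi]
        have : 1 ≤ ∏ x ∈ (range T).erase i, (1 + q x) := 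
          Finset.one_le_prod fun j _ => by linarith [hq j]
        nlinarith [hq i]
      have := hq i
      norm_num at h
      linarith
    rw [prod_eq_zero (mem_range.2 hT) (h0 0 (mem_range.2 hT))]
    positivity
  -- Bernoulli's inequality with exponent `(1 + a) / a ≥ 1`, an equality at `q = a`.
  have h1 : ∀ i ∈ range T, q i / a ≤ ((1 + q i) / (1 + a)) ^ ((1 + a) / a) := by
    intro i _
    have hqi := hq i
    have h2 := one_add_mul_self_le_rpow_one_add (s := (q i - a) / (1 + a)) (p := (1 + a) / a)
      (by rw [le_div_iff₀ (by linarith)]; linarith)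
      (by rw [le_div_iff₀ ha]; linarith)
    have h3 : 1 + (q i - a) / (1 + a) = (1 + q i) / (1 + a) := by field_simp; ring
    have h4 : 1 + (1 + a) / a * ((q i - a) / (1 + a)) = q i / a := by field_simp; ring
    rwa [h3, h4] at h2
  have h2 : ∏ i ∈ range T, (q i / a) ≤ 1 := by
    calc _ ≤ ∏ i ∈ range T, ((1 + q i) / (1 + a)) ^ ((1 + a) / a) :=
          prod_le_prod (fun i _ => div_nonneg (hq i) ha.le) h1
      _ = (∏ i ∈ range T, ((1 + q i) / (1 + a))) ^ ((1 + a) / a) :=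
          Real.finsetProd_rpow _ _ (fun i _ => div_nonneg (by linarith [hq i]) (by linarith)) _
      _ ≤ 1 := by
          refine Real.rpow_le_one (prod_nonneg fun i _ => div_nonneg (by linarith [hq i])
            (by linarith)) ?_ (by positivity)
          rw [prod_div_distrib, prod_const, card_range]
          exact div_le_one_of_le₀ h (by positivity)
  rw [prod_div_distrib, prod_const, card_range] at h2
  rwa [div_le_one (by positivity)] at h2

/-- The error and the matrix of the quasi-Newton iteration for a quadratic, in coordinates in which
the Hessian is the identity. -/
noncomputable def newtonSeq {n : ℕ} (z : E n) (K : E n →L[ℝ] E n) : ℕ → E n × (E n →L[ℝ] E n)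
  | 0 => (z, K)
  | t + 1 =>
    let p := newtonSeq z K t
    (p.1 - p.2 p.1, bfgsUpdate p.2 (p.2 p.1) (p.2 p.1))

theorem IsBetween.newtonSeq {n : ℕ} {m : ℝ} {K : E n →L[ℝ] E n} (h : IsBetween m K) (hm : m ≤ 1)
    (z : E n) (t : ℕ) : IsBetween m (newtonSeq z K t).2 := by
  induction t with
  | zero => exact h
  | succ t ih => exact ih.bfgsUpdate hm _

/-- The determinant grows from at least `m^n` to at most `1`, which bounds the product of the
contraction factors of the energy. -/
theorem IsBetween.norm_newtonSeq_sq_le {n : ℕ} {m : ℝ} {K : E n →L[ℝ] E n} (h : IsBetween m K)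
    (hm : 0 < m) (hm1 : m ≤ 1) (z : E n) (T : ℕ) (hT : 0 < T)
    (hTb : 4 * n * Real.log (1 / m) ≤ T) :
    m * ‖(QNBO.newtonSeq z K T).1‖ ^ 2
      ≤ (4 * n * Real.log (1 / m) / T) ^ T * ‖z‖ ^ 2 := by
  have hlog : 0 ≤ Real.log (1 / m) := Real.log_nonneg (by rw [le_div_iff₀ hm]; linarith)
  have hTpos : (0 : ℝ) < T := Nat.cast_pos.2 hT
  rcases eq_or_ne (QNBO.newtonSeq z K T).1 0 with h0 | h0
  · rw [h0, norm_zero]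
    simp only [ne_eq, OfNat.ofNat_ne_zero, not_false_eq_true, zero_pow, mul_zero]
    positivity
  set w := QNBO.newtonSeq z K with hw
  have hstep1 : ∀ t, (w (t + 1)).1 = (w t).1 - (w t).2 (w t).1 := fun t => rfl
  have hstep2 : ∀ t, (w (t + 1)).2
      = QNBO.bfgsUpdate (w t).2 ((w t).2 (w t).1) ((w t).2 (w t).1) := fun t => rfl
  have hK : ∀ t, IsBetween m (w t).2 := h.newtonSeq hm1 z
  have hne : ∀ t ≤ T, (w t).1 ≠ 0 := by
    intro t ht hz
    have : ∀ j, (w (t + j)).1 = 0 := by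
      intro j
      induction j with
      | zero => exact hz
      | succ j ih => rw [← add_assoc, hstep1, ih]; simp
    exact h0 (by rw [← Nat.add_sub_of_le ht]; exact this _)
  set e : ℕ → ℝ := fun t => inner ℝ ((w t).2 (w t).1) (w t).1 with he
  -- The value `0` for `t > T`, where `z_t` may vanish, only makes `q` nonnegative everywhere.
  set q : ℕ → ℝ := fun t => if t ≤ T then e t / ‖(w t).2 (w t).1‖ ^ 2 - 1 else 0 with hqdef
  have hq : ∀ t, 0 ≤ q t := by
    intro t
    simp only [hqdef]
    split_ifs with ht
    · have := (hK t).apply_ne_zero hm (hne t ht)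
      have h1 : 1 ≤ e t / ‖(w t).2 (w t).1‖ ^ 2 := by
        rw [one_le_div (by positivity)]
        exact (hK t).norm_sq_le hm.le _
      linarith
    · exact le_rfl
  have hq' : ∀ t ≤ T, q t = e t / ‖(w t).2 (w t).1‖ ^ 2 - 1 := fun t ht => if_pos ht
  have henergy : ∀ t ≤ T, e t ≤ (∏ i ∈ range t, (2 * q i)) * ‖z‖ ^ 2 := by
    intro t
    induction t with
    | zero => intro _; simpa [he, hw, QNBO.newtonSeq] using h.upper z
    | succ t ih =>
      intro ht
      have h1 := (hK t).energy_step hm (hne t (by omega))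
      rw [← hstep1, ← hstep2] at h1
      have h2 := ih (by omega)
      have h3 := hq t
      have h4 := mul_le_mul_of_nonneg_left h2 (by positivity : 0 ≤ 2 * q t)
      rw [prod_range_succ]
      calc e (t + 1) ≤ 2 * q t * e t := by rw [hq' t (by omega)]; exact h1
        _ ≤ _ := by linarith
  have hdet : ∀ t ≤ T, m ^ n * ∏ i ∈ range t, (1 + q i)
      ≤ LinearMap.det ((w t).2 : E n →ₗ[ℝ] E n) := by
    intro t
    induction t with
    | zero => intro _; simpa [hw, QNBO.newtonSeq] using (h.det_mem_Icc hm.le).1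
    | succ t ih =>
      intro ht
      have h1 := (hK t).det_bfgsUpdate hm (hne t (by omega))
      rw [← hstep2] at h1
      have h2 : 1 + q t = e t / ‖(w t).2 (w t).1‖ ^ 2 := by rw [hq' t (by omega)]; ring
      rw [h1, prod_range_succ, ← mul_assoc]
      have h4 := mul_le_mul_of_nonneg_left (ih (by omega))
        (by linarith [hq t] : 0 ≤ 1 + q t)
      rw [h2] at h4 ⊢
      linarith
  have hprod : ∏ i ∈ range T, (1 + q i) ≤ (1 / m) ^ n := by
    have h1 := (hdet T le_rfl).trans ((hK T).det_mem_Icc hm.le).2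
    rw [one_div, inv_pow, ← one_div, le_div_iff₀ (by positivity)]
    linarith
  set s := n * Real.log (1 / m) / T with hs
  have hs0 : 0 ≤ s := by positivity
  have hs4 : s ≤ 1 / 4 := by
    rw [hs, div_le_iff₀ hTpos]
    linarith
  have hexp : (1 / m) ^ n ≤ (1 + 2 * s) ^ T := by
    have h1 : (1 / m) ^ n = Real.exp s ^ T := by
      rw [← Real.exp_nat_mul, hs, mul_div_cancel₀ _ hTpos.ne', Real.exp_nat_mul,
        Real.exp_log (by positivity)]
    have h2 : Real.exp s ≤ 1 + 2 * s := by
      have := Real.abs_exp_sub_one_le (x := s) (by rw [abs_of_nonneg hs0]; linarith)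
      rw [abs_of_nonneg hs0] at this
      linarith [le_abs_self (Real.exp s - 1)]
    rw [h1]
    exact pow_le_pow_left₀ (Real.exp_pos _).le h2 T
  have hqprod := prod_le_pow_of_prod_one_add_le q hq T hT (2 * s) (by positivity)
    (hprod.trans hexp)
  calc m * ‖(w T).1‖ ^ 2 ≤ e T := (hK T).lower _
    _ ≤ (∏ i ∈ range T, (2 * q i)) * ‖z‖ ^ 2 := henergy T le_rfl
    _ = 2 ^ T * (∏ i ∈ range T, q i) * ‖z‖ ^ 2 := by
        rw [prod_mul_distrib, prod_const, card_range]
    _ ≤ 2 ^ T * (2 * s) ^ T * ‖z‖ ^ 2 := by gcongr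
    _ = _ := by
        rw [← mul_pow, hs]
        congr 2
        ring

/-! ### The quadratic lower-level problem -/

/-- `A` is symmetric with spectrum in `[μ, L]`. -/
structure HessianBounds {n : ℕ} (μ L : ℝ) (A : E n →L[ℝ] E n) : Prop where
  symm : ∀ x y, inner ℝ (A x) y = inner ℝ x (A y)
  lower : ∀ x, μ * ‖x‖ ^ 2 ≤ inner ℝ (A x) x
  upper : ∀ x, inner ℝ (A x) x ≤ L * ‖x‖ ^ 2

/-- The operator on Euclidean space given by a matrix. -/
noncomputable abbrev op {n : ℕ} (A : Matrix (Fin n) (Fin n) ℝ) : E n →L[ℝ] E n :=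
  Matrix.toEuclideanCLM (n := Fin n) (𝕜 := ℝ) A

theorem inner_op_nonneg {n : ℕ} {A : Matrix (Fin n) (Fin n) ℝ} (h : A.PosSemidef) (x : E n) :
    0 ≤ inner ℝ (op A x) x := by
  have := h.dotProduct_mulVec_nonneg x.ofLp
  rw [real_inner_comm, Matrix.inner_toEuclideanCLM]
  simpa [dotProduct_comm] using this

theorem inner_op_symm {n : ℕ} {A : Matrix (Fin n) (Fin n) ℝ} (h : A.IsHermitian) (x y : E n) :
    inner ℝ (op A x) y = inner ℝ x (op A y) :=
  Matrix.isSymmetric_toEuclideanLin_iff.2 h x y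

theorem HessianBounds.of_posSemidef {n : ℕ} {A : Matrix (Fin n) (Fin n) ℝ} {μ L : ℝ}
    (hμA : (A - μ • (1 : Matrix (Fin n) (Fin n) ℝ)).PosSemidef)
    (hAL : (L • (1 : Matrix (Fin n) (Fin n) ℝ) - A).PosSemidef) : HessianBounds μ L (op A) where
  symm := inner_op_symm (by
    have := hμA.isHermitian.add (Matrix.isHermitian_one.smul (k := μ) (by simp [IsSelfAdjoint]))
    simpa using this)
  lower x := by
    have := inner_op_nonneg hμA x
    simp only [op, map_sub, map_smul, map_one, _root_.sub_apply, _root_.smul_apply,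
      one_apply_eq_self, inner_sub_left, inner_smul_left, RCLike.conj_to_real,
      real_inner_self_eq_norm_sq] at this
    linarith
  upper x := by
    have := inner_op_nonneg hAL x
    simp only [op, map_sub, map_smul, map_one, _root_.sub_apply, _root_.smul_apply,
      one_apply_eq_self, inner_sub_left, inner_smul_left, RCLike.conj_to_real,
      real_inner_self_eq_norm_sq] at this
    linarith

open scoped MatrixOrder in
theorem exists_symm_sqrt {n : ℕ} {A : Matrix (Fin n) (Fin n) ℝ} (h : A.PosSemidef) :
    ∃ S : E n →L[ℝ] E n, (∀ x y, inner ℝ (S x) y = inner ℝ x (S y)) ∧ S ∘L S = op A := by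
  refine ⟨op (CFC.sqrt A), inner_op_symm (Matrix.nonneg_iff_posSemidef.1 (CFC.sqrt_nonneg A)).isHermitian, ?_⟩
  have := CFC.sqrt_mul_sqrt_self A h.nonneg
  conv_rhs => rw [← this]
  rw [op, op, map_mul]
  rfl

theorem quadLower_eq {n : ℕ} (A : Matrix (Fin n) (Fin n) ℝ) (x y : E n) :
    quadLower A x y = 1 / 2 * inner ℝ (op A y) y - inner ℝ x y := by
  rw [quadLower, real_inner_comm y (op A y), Matrix.inner_toEuclideanCLM,
    EuclideanSpace.inner_eq_star_dotProduct]
  simp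

theorem gradY_quadLower {n : ℕ} {A : Matrix (Fin n) (Fin n) ℝ}
    (hA : ∀ x y, inner ℝ (op A x) y = inner ℝ x (op A y)) (x y : E n) :
    gradY (quadLower A) x y = op A y - x := by
  refine HasGradientAt.gradient ?_
  rw [hasGradientAt_iff_hasFDerivAt]
  have h1 : HasFDerivAt (fun z : E n => 1 / 2 * inner ℝ (op A z) z - inner ℝ x z) _ y :=
    ((((op A).hasFDerivAt (x := y)).inner ℝ (hasFDerivAt_id y)).const_mul (1 / 2)).sub
      ((hasFDerivAt_const x y).inner ℝ (hasFDerivAt_id y))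
  have h2 : (fun z : E n => quadLower A x z)
      = fun z : E n => 1 / 2 * inner ℝ (op A z) z - inner ℝ x z := by
    funext z
    exact quadLower_eq A x z
  rw [h2]
  refine h1.congr_fderiv ?_
  ext1 v
  simp [hA v y, real_inner_comm v (op A y)]
  ring

theorem jacXY_quadLower {n : ℕ} {A : Matrix (Fin n) (Fin n) ℝ}
    (hA : ∀ x y, inner ℝ (op A x) y = inner ℝ x (op A y)) (x y : E n) :
    jacXY (quadLower A) x y = -ContinuousLinearMap.id ℝ (E n) := by
  have h : (fun x' => gradY (quadLower A) x' y) = fun x' : E n => op A y - x' := by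
    funext x'
    exact gradY_quadLower hA x' y
  rw [jacXY, h]
  exact ((hasFDerivAt_id x).const_sub (op A y)).fderiv

/-- A positive definite operator has an inverse, of norm at most `1 / μ`. -/
theorem HessianBounds.exists_inverse {n : ℕ} {A : E n →L[ℝ] E n} {μ L : ℝ}
    (h : HessianBounds μ L A) (hμ : 0 < μ) :
    ∃ B : E n →L[ℝ] E n, (∀ x, A (B x) = x) ∧
      (∀ x y, inner ℝ (B x) y = inner ℝ x (B y)) ∧ ∀ x, ‖B x‖ ≤ 1 / μ * ‖x‖ := by
  have hinj : LinearMap.ker (A : E n →ₗ[ℝ] E n) = ⊥ := by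
    rw [LinearMap.ker_eq_bot']
    intro x hx
    have h1 := h.lower x
    rw [ContinuousLinearMap.coe_coe] at hx
    rw [hx, inner_zero_left] at h1
    by_contra h0
    have : 0 < μ * ‖x‖ ^ 2 := by positivity
    linarith
  obtain ⟨B, hB⟩ := LinearMap.exists_leftInverse_of_injective _ hinj
  have hAB : ∀ x, A (B x) = x := fun x =>
    LinearMap.congr_fun (mul_eq_one_comm.1 hB : (A : E n →ₗ[ℝ] E n) * B = 1) x
  refine ⟨LinearMap.toContinuousLinearMap B, hAB, fun x y => ?_, fun x => ?_⟩
  · change inner ℝ (B x) y = inner ℝ x (B y)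
    conv_lhs => rw [← hAB y]
    rw [← h.symm, hAB]
  · change ‖B x‖ ≤ 1 / μ * ‖x‖
    have h1 := h.lower (B x)
    rw [hAB] at h1
    have h2 := real_inner_le_norm x (B x)
    rw [div_mul_eq_mul_div, le_div_iff₀ hμ]
    rcases eq_or_ne (B x) 0 with h0 | h0
    · simp [h0]
    · have : 0 < ‖B x‖ := norm_pos_iff.2 h0
      nlinarith

theorem lowerSol_quadLower {n : ℕ} {A : Matrix (Fin n) (Fin n) ℝ} {μ L : ℝ}
    (h : HessianBounds μ L (op A)) (hμ : 0 < μ) {B : E n →L[ℝ] E n} (hB : ∀ x, op A (B x) = x)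
    (x : E n) : lowerSol (quadLower A) x = B x := by
  have hexp : ∀ z, quadLower A x z
      = quadLower A x (B x) + 1 / 2 * inner ℝ (op A (z - B x)) (z - B x) := by
    intro z
    simp only [quadLower_eq, map_sub, inner_sub_left, inner_sub_right, hB]
    rw [h.symm z (B x), hB, real_inner_comm x z]
    ring
  have hmin : ∃ y, ∀ z, quadLower A x y ≤ quadLower A x z := ⟨B x, fun z => by
    rw [hexp z]
    have := h.lower (z - B x)
    have : 0 ≤ μ * ‖z - B x‖ ^ 2 := by positivity
    linarith⟩
  have hspec := Classical.epsilon_spec hmin (B x)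
  change quadLower A x (lowerSol (quadLower A) x) ≤ _ at hspec
  rw [hexp] at hspec
  have h1 := h.lower (lowerSol (quadLower A) x - B x)
  by_contra h0
  have : 0 < ‖lowerSol (quadLower A) x - B x‖ := norm_pos_iff.2 (sub_ne_zero.2 h0)
  have : 0 < μ * ‖lowerSol (quadLower A) x - B x‖ ^ 2 := by positivity
  linarith

/-! ### The subroutines in normalized coordinates -/

theorem HessianBounds.norm_sqrt_sq {n : ℕ} {A S : E n →L[ℝ] E n}
    (hS : ∀ x y, inner ℝ (S x) y = inner ℝ x (S y)) (hSA : S ∘L S = A) (x : E n) :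
    ‖S x‖ ^ 2 = inner ℝ (A x) x := by
  rw [← real_inner_self_eq_norm_sq, ← hS, ← hSA]
  rfl

theorem HessianBounds.isBetween {n : ℕ} {A S : E n →L[ℝ] E n} {μ L : ℝ} (h : HessianBounds μ L A)
    (hL : 0 < L) (hSA : S ∘L S = A) :
    IsBetween (μ / L) (S ∘L (L⁻¹ • ContinuousLinearMap.id ℝ (E n)) ∘L S) := by
  have hK : S ∘L (L⁻¹ • ContinuousLinearMap.id ℝ (E n)) ∘L S = L⁻¹ • A := by
    rw [← hSA]
    ext1 x
    simp
  rw [hK]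
  refine ⟨fun x y => ?_, fun x => ?_, fun x => ?_⟩
  · simp [inner_smul_left, inner_smul_right, h.symm]
  · rw [_root_.smul_apply, inner_smul_left, RCLike.conj_to_real, div_eq_inv_mul, mul_assoc]
    exact mul_le_mul_of_nonneg_left (h.lower x) (by positivity)
  · rw [_root_.smul_apply, inner_smul_left, RCLike.conj_to_real, inv_mul_le_iff₀ hL]
    exact h.upper x

/-- With `A = S²`, `z_t = S (y_t - y*)` and `K_t = S H_t S`, the quasi-Newton iteration for
`f(x, ·)` becomes the normalized one. -/
theorem newtonSeq_eq_subA {n : ℕ} {A : Matrix (Fin n) (Fin n) ℝ} {S : E n →L[ℝ] E n}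
    (hA : ∀ x y, inner ℝ (op A x) y = inner ℝ x (op A y))
    (hS : ∀ x y, inner ℝ (S x) y = inner ℝ x (S y)) (hSA : S ∘L S = op A)
    (H : E n →L[ℝ] E n) (β : ℝ) (x y ys : E n) (hys : op A ys = x) (T : ℕ) :
    newtonSeq (S (y - ys)) (S ∘L H ∘L S) T
      = (S ((subA (quadLower A) H β 1 0 T x y).1 - ys),
          S ∘L (subA (quadLower A) H β 1 0 T x y).2 ∘L S) := by
  have hA' : ∀ x, op A x = S (S x) := fun x => by rw [← hSA]; rfl
  induction T with
  | zero => rfl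
  | succ T ih =>
    have hstep : subA (quadLower A) H β 1 0 (T + 1) x y
        = qnStep (quadLower A) 1 x (subA (quadLower A) H β 1 0 T x y) := by
      simp only [subA, Function.iterate_succ_apply']
    rw [hstep]
    set p := subA (quadLower A) H β 1 0 T x y with hp
    have hu : S (p.2 (op A p.1 - x)) = (S ∘L p.2 ∘L S) (S (p.1 - ys)) := by
      rw [← hys, ← map_sub, hA']
      rfl
    have hg : ∀ s, op A (p.1 - s) - x - (op A p.1 - x) = op A (-s) := fun s => by
      rw [map_sub, map_neg]
      abel
    rw [newtonSeq, ih]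
    simp only [qnStep, gradY_quadLower hA, one_smul, hg, sub_sub_cancel_left]
    rw [bfgsUpdate_conj _ S _ hS hSA, map_neg, hu, ← neg_one_smul ℝ,
      bfgsUpdate_smul_self _ _ (by norm_num), sub_right_comm, map_sub S (p.1 - ys), hu]

/-- With `A = S²` and `d = A v`, the matrices `S H_i S` are the normalized updates along the
images of `S v`. The lengths `ξ_i` do not matter since the update is invariant under scaling. -/
theorem fixedSeq_eq_matB {n : ℕ} {A : Matrix (Fin n) (Fin n) ℝ} {S : E n →L[ℝ] E n}
    (hA : ∀ x y, inner ℝ (op A x) y = inner ℝ x (op A y))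
    (hS : ∀ x y, inner ℝ (S x) y = inner ℝ x (S y)) (hSA : S ∘L S = op A)
    (H : E n →L[ℝ] E n) {ξ : ℕ → ℝ} (hξ : ∀ i, 0 < ξ i) (x y v : E n) (i : ℕ) :
    fixedSeq (S ∘L H ∘L S) (S v) i = S ∘L matB (quadLower A) H ξ x y (op A v) i ∘L S := by
  have hA' : ∀ x, op A x = S (S x) := fun x => by rw [← hSA]; rfl
  induction i with
  | zero => rfl
  | succ i ih =>
    have hg : ∀ s, op A (y + s) - x - (op A y - x) = op A s := fun s => by
      rw [map_add]
      abel
    rw [fixedSeq, ih]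
    simp only [matB, gradY_quadLower hA, hg]
    rw [bfgsUpdate_conj _ S _ hS hSA, map_smul, bfgsUpdate_smul_self _ _ (hξ i).ne', hA' v]
    rfl

theorem ct_sq {n : ℕ} {μ L : ℝ} (htb : 0 ≤ tb n μ L) (T : ℕ) :
    ct n μ L T ^ 2 = 4 * tb n μ L ^ T := by
  rw [ct, mul_pow, ← Real.rpow_natCast (tb n μ L ^ ((T : ℝ) / 2)) 2, ← Real.rpow_mul htb]
  norm_num

/-- Superlinear convergence of subroutine `𝒜`. Passing between `‖·‖` and the energy norm costs two
factors `κ`, so `κ² (t_b / T)^T` already bounds the left-hand side. -/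
theorem norm_subA_sub_sq_le {n : ℕ} {A : Matrix (Fin n) (Fin n) ℝ} {μ L : ℝ} (hμ : 0 < μ)
    (hμL : μ ≤ L) (h : HessianBounds μ L (op A)) {S : E n →L[ℝ] E n}
    (hS : ∀ x y, inner ℝ (S x) y = inner ℝ x (S y)) (hSA : S ∘L S = op A)
    (β : ℝ) (x y ys : E n) (hys : op A ys = x) {T : ℕ} (hT : 0 < T) (hTb : tb n μ L ≤ T) :
    ‖(subA (quadLower A) (L⁻¹ • ContinuousLinearMap.id ℝ (E n)) β 1 0 T x y).1 - ys‖ ^ 2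
      ≤ rate n μ L T * ‖y - ys‖ ^ 2 := by
  have hL : 0 < L := hμ.trans_le hμL
  have hm : 0 < μ / L := by positivity
  have hm1 : μ / L ≤ 1 := div_le_one_of_le₀ hμL hL.le
  have hκ1 : 1 ≤ L / μ := (one_le_div hμ).2 hμL
  have htb0 : 0 ≤ tb n μ L := by
    have := Real.log_nonneg hκ1
    unfold tb
    positivity
  have hTpos : (0 : ℝ) < T := Nat.cast_pos.2 hT
  have h1 := (h.isBetween hL hSA).norm_newtonSeq_sq_le hm hm1 (S (y - ys)) T hT
    (by rw [one_div_div]; exact hTb)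
  rw [newtonSeq_eq_subA h.symm hS hSA _ β x y ys hys, one_div_div] at h1
  simp only [HessianBounds.norm_sqrt_sq hS hSA] at h1
  set w := (subA (quadLower A) (L⁻¹ • ContinuousLinearMap.id ℝ (E n)) β 1 0 T x y).1 - ys
  have h2 := h.lower w
  have h3 := h.upper (y - ys)
  change μ / L * _ ≤ (tb n μ L / T) ^ T * _ at h1
  set c := (tb n μ L / T) ^ T with hc
  have hc0 : 0 ≤ c := by positivity
  have hrate : rate n μ L T = 4 * (L / μ) ^ 3 * c := by
    rw [rate, ct_sq htb0, hc, div_pow, div_pow, one_pow]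
    ring
  have h4 : μ / L * (μ * ‖w‖ ^ 2) ≤ c * (L * ‖y - ys‖ ^ 2) :=
    (mul_le_mul_of_nonneg_left h2 hm.le).trans (h1.trans (mul_le_mul_of_nonneg_left h3 hc0))
  have h5 : ‖w‖ ^ 2 ≤ (L / μ) ^ 2 * c * ‖y - ys‖ ^ 2 := by
    calc ‖w‖ ^ 2 = (L / μ) / μ * (μ / L * (μ * ‖w‖ ^ 2)) := by field_simp
      _ ≤ (L / μ) / μ * (c * (L * ‖y - ys‖ ^ 2)) := mul_le_mul_of_nonneg_left h4 (by positivity)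
      _ = _ := by field_simp
  have h6 : (L / μ) ^ 2 ≤ 4 * (L / μ) ^ 3 := by nlinarith [sq_nonneg (L / μ)]
  rw [hrate]
  exact h5.trans (by gcongr)

/-- From an estimate of the residual in normalized coordinates to the error `H d - A⁻¹ d`. -/
theorem norm_apply_sub_sq_le {n : ℕ} {A S H : E n →L[ℝ] E n} {μ L c : ℝ} (hμ : 0 < μ)
    (h : HessianBounds μ L A) (hS : ∀ x y, inner ℝ (S x) y = inner ℝ x (S y)) (hSA : S ∘L S = A)
    (hc : 0 ≤ c) {B : E n →L[ℝ] E n} (hAB : ∀ x, A (B x) = x) (hB : ∀ x, ‖B x‖ ≤ 1 / μ * ‖x‖)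
    (d : E n)
    (hres : ‖S (B d) - (S ∘L H ∘L S) (S (B d))‖ ^ 2 ≤ c * ‖S (B d)‖ ^ 2) :
    ‖H d - B d‖ ^ 2 ≤ c * (‖d‖ ^ 2 / μ ^ 2) := by
  have h0 : S (B d) - (S ∘L H ∘L S) (S (B d)) = S (B d - H d) := by
    have : S (S (B d)) = d := by
      conv_rhs => rw [← hAB d, ← hSA]
      rfl
    rw [map_sub, ContinuousLinearMap.comp_apply, ContinuousLinearMap.comp_apply, this]
  rw [h0, HessianBounds.norm_sqrt_sq hS hSA, HessianBounds.norm_sqrt_sq hS hSA, hAB] at hres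
  have h1 := h.lower (B d - H d)
  have h2 : inner ℝ d (B d) ≤ ‖d‖ * (1 / μ * ‖d‖) :=
    (real_inner_le_norm _ _).trans (mul_le_mul_of_nonneg_left (hB d) (norm_nonneg _))
  have h3 := mul_le_mul_of_nonneg_left h2 hc
  rw [norm_sub_rev]
  have h4 : ‖B d - H d‖ ^ 2 ≤ c * (‖d‖ * (1 / μ * ‖d‖)) / μ := by
    rw [le_div_iff₀ hμ]
    linarith
  refine h4.trans (le_of_eq ?_)
  field_simp

/-- Subroutine `ℬ` solves `A v = d` up to a squared error of order `1 / Q`, here with `Q = k + 1`. -/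
theorem norm_subB_sub_sq_le {n : ℕ} {A : Matrix (Fin n) (Fin n) ℝ} {μ L : ℝ} (hμ : 0 < μ)
    (hμL : μ ≤ L) (h : HessianBounds μ L (op A)) {S : E n →L[ℝ] E n}
    (hS : ∀ x y, inner ℝ (S x) y = inner ℝ x (S y)) (hSA : S ∘L S = op A)
    {B : E n →L[ℝ] E n} (hAB : ∀ x, op A (B x) = x) (hB : ∀ x, ‖B x‖ ≤ 1 / μ * ‖x‖)
    {ξ : ℕ → ℝ} (hξ : ∀ i, 0 < ξ i) (x y d : E n) (k : ℕ) :
    ‖subB (quadLower A) (L⁻¹ • ContinuousLinearMap.id ℝ (E n)) ξ x y d (k + 1) - B d‖ ^ 2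
      ≤ n * (L / μ - 1) / (k + 1) * (‖d‖ ^ 2 / μ ^ 2) := by
  have hL : 0 < L := hμ.trans_le hμL
  have hm : 0 < μ / L := by positivity
  have hm1 : μ / L ≤ 1 := div_le_one_of_le₀ hμL hL.le
  have hκ1 : 1 ≤ L / μ := (one_le_div hμ).2 hμL
  refine norm_apply_sub_sq_le hμ h hS hSA ?_ hAB hB d ?_
  · have : 0 ≤ L / μ - 1 := by linarith
    positivity
  · have h1 := (h.isBetween hL hSA).norm_residual_fixedSeq_sq_le hm hm1 (S (B d)) k
    rw [fixedSeq_eq_matB h.symm hS hSA _ hξ x y, hAB, one_div_div] at h1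
    refine h1.trans (le_of_eq ?_)
    ring

/-- The matrix that subroutine `𝒜` returns need not be close to `A⁻¹`: this bound uses only that
`S H_T S` has its spectrum in `[μ / L, 1]`. -/
theorem norm_subA_matrix_sub_sq_le {n : ℕ} {A : Matrix (Fin n) (Fin n) ℝ} {μ L : ℝ} (hμ : 0 < μ)
    (hμL : μ ≤ L) (h : HessianBounds μ L (op A)) {S : E n →L[ℝ] E n}
    (hS : ∀ x y, inner ℝ (S x) y = inner ℝ x (S y)) (hSA : S ∘L S = op A)
    {B : E n →L[ℝ] E n} (hAB : ∀ x, op A (B x) = x) (hB : ∀ x, ‖B x‖ ≤ 1 / μ * ‖x‖)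
    (β : ℝ) (x y d : E n) (T : ℕ) :
    ‖(subA (quadLower A) (L⁻¹ • ContinuousLinearMap.id ℝ (E n)) β 1 0 T x y).2 d - B d‖ ^ 2
      ≤ (1 - μ / L) * (‖d‖ ^ 2 / μ ^ 2) := by
  have hL : 0 < L := hμ.trans_le hμL
  have hm : 0 < μ / L := by positivity
  have hm1 : μ / L ≤ 1 := div_le_one_of_le₀ hμL hL.le
  refine norm_apply_sub_sq_le hμ h hS hSA (by linarith) hAB hB d ?_
  have hK := (h.isBetween hL hSA).newtonSeq hm1 (S (y - B x)) T
  rw [newtonSeq_eq_subA h.symm hS hSA _ β x y (B x) (hAB x)] at hK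
  have h1 := hK.norm_sub_sq_le hm.le (S (B d))
  have h2 := hK.lower (S (B d))
  linarith

/-! ### The gradient of the bilevel objective -/

/-- `∇Φ(x) = ∇ₓ F(x, B x) + B ∇_y F(x, B x)` for `Φ(x) = F(x, B x)` with `B` symmetric. -/
noncomputable def hyperGrad {n : ℕ} (F : E n → E n → ℝ) (B : E n →L[ℝ] E n) (x : E n) : E n :=
  gradX F x (B x) + B (gradY F x (B x))

theorem hasGradientAt_comp_linear {n : ℕ} {F : E n → E n → ℝ}
    (hF : Differentiable ℝ fun p : E n × E n => F p.1 p.2) {B : E n →L[ℝ] E n}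
    (hB : ∀ x y, inner ℝ (B x) y = inner ℝ x (B y)) (x : E n) :
    HasGradientAt (fun x => F x (B x)) (hyperGrad F B x) x := by
  have hG := (hF (x, B x)).hasFDerivAt
  set G' := fderiv ℝ (fun p : E n × E n => F p.1 p.2) (x, B x) with hG'
  have hx : HasFDerivAt (fun x' => F x' (B x)) (G' ∘L ContinuousLinearMap.inl ℝ (E n) (E n)) x :=
    HasFDerivAt.comp (g := fun p : E n × E n => F p.1 p.2) (f := fun e => (e, B x)) x hG
      (hasFDerivAt_prodMk_left x (B x))
  have hy : HasFDerivAt (fun y' => F x y') (G' ∘L ContinuousLinearMap.inr ℝ (E n) (E n)) (B x) :=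
    hG.comp (B x) (hasFDerivAt_prodMk_right x (B x))
  have hgx : ∀ v, inner ℝ (gradX F x (B x)) v = G' (v, 0) := fun v => by
    rw [gradX, hx.hasGradientAt.gradient, InnerProductSpace.toDual_symm_apply]
    rfl
  have hgy : ∀ v, inner ℝ (gradY F x (B x)) v = G' (0, v) := fun v => by
    rw [gradY, hy.hasGradientAt.gradient, InnerProductSpace.toDual_symm_apply]
    rfl
  rw [hasGradientAt_iff_hasFDerivAt]
  have hΦ : HasFDerivAt (fun x => F x (B x))
      (G' ∘L (ContinuousLinearMap.id ℝ (E n)).prod B) x :=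
    HasFDerivAt.comp (g := fun p : E n × E n => F p.1 p.2) (f := fun e => (e, B e)) x hG
      ((hasFDerivAt_id x).prodMk B.hasFDerivAt)
  refine hΦ.congr_fderiv ?_
  ext1 v
  rw [InnerProductSpace.toDual_apply_apply, hyperGrad, inner_add_left, hB, hgx, hgy, ← map_add]
  simp

theorem LPhi_nonneg {μ : ℝ} (hμ : 0 < μ) (LFx LFy LFy' : ℝ≥0) : 0 ≤ LPhi μ LFx LFy LFy' := by
  unfold LPhi
  positivity

theorem norm_hyperGrad_sub_le {n : ℕ} {F : E n → E n → ℝ} {LFx LFy LFy' : ℝ≥0} {CFy μ : ℝ}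
    (hμ : 0 < μ) (hF : UpperAssumption F LFx LFy LFy' CFy) {B : E n →L[ℝ] E n}
    (hB : ∀ x, ‖B x‖ ≤ 1 / μ * ‖x‖) (x x' : E n) :
    ‖hyperGrad F B x - hyperGrad F B x'‖ ≤ LPhi μ LFx LFy LFy' * ‖x - x'‖ := by
  have hy : ‖B x - B x'‖ ≤ 1 / μ * ‖x - x'‖ := by rw [← map_sub]; exact hB _
  have h1 := (hF.gradX_lipschitz_x (B x)).norm_sub_le x x'
  have h2 := (hF.gradX_lipschitz_y x').norm_sub_le (B x) (B x')
  have h3 := (hF.gradY_lipschitz_x (B x)).norm_sub_le x x'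
  have h4 := (hF.gradY_lipschitz_y x').norm_sub_le (B x) (B x')
  have h2' := h2.trans (mul_le_mul_of_nonneg_left hy LFx.coe_nonneg)
  have h4' := h4.trans (mul_le_mul_of_nonneg_left hy LFy.coe_nonneg)
  have hd : hyperGrad F B x - hyperGrad F B x'
      = ((gradX F x (B x) - gradX F x' (B x)) + (gradX F x' (B x) - gradX F x' (B x')))
        + B ((gradY F x (B x) - gradY F x' (B x)) + (gradY F x' (B x) - gradY F x' (B x'))) := by
    simp only [hyperGrad, map_add, map_sub]
    abel
  rw [hd]
  refine (norm_add_le _ _).trans ?_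
  have h5 := norm_add_le (gradX F x (B x) - gradX F x' (B x))
    (gradX F x' (B x) - gradX F x' (B x'))
  have h6 := (hB ((gradY F x (B x) - gradY F x' (B x))
    + (gradY F x' (B x) - gradY F x' (B x')))).trans
    (mul_le_mul_of_nonneg_left (norm_add_le _ _) (by positivity))
  have h7 : 1 / μ * (‖gradY F x (B x) - gradY F x' (B x)‖
      + ‖gradY F x' (B x) - gradY F x' (B x')‖)
      ≤ 1 / μ * (LFy' * ‖x - x'‖ + LFy * (1 / μ * ‖x - x'‖)) := by gcongr
  have h8 : LPhi μ LFx LFy LFy' * ‖x - x'‖ = (LFx * ‖x - x'‖ + LFx * (1 / μ * ‖x - x'‖))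
      + 1 / μ * (LFy' * ‖x - x'‖ + LFy * (1 / μ * ‖x - x'‖)) := by
    unfold LPhi
    field_simp
    ring
  rw [h8]
  linarith

/-- The descent lemma for a function with `ℓ`-Lipschitz gradient. -/
theorem descent_lemma {n : ℕ} {Φ : E n → ℝ} {g : E n → E n} (hΦ : ∀ x, HasGradientAt Φ (g x) x)
    {ℓ : ℝ} (hg : ∀ x y, ‖g x - g y‖ ≤ ℓ * ‖x - y‖) (x v : E n) :
    Φ (x + v) ≤ Φ x + inner ℝ (g x) v + ℓ / 2 * ‖v‖ ^ 2 := by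
  set φ : ℝ → ℝ := fun t => Φ (x + t • v) - t * inner ℝ (g x) v - ℓ / 2 * ‖v‖ ^ 2 * t ^ 2 with hφ
  have hline : ∀ t : ℝ, HasDerivAt (fun t : ℝ => x + t • v) v t := fun t => by
    simpa using ((hasDerivAt_id t).smul_const v).const_add x
  have hderiv : ∀ t : ℝ, HasDerivAt φ
      (inner ℝ (g (x + t • v)) v - inner ℝ (g x) v - ℓ / 2 * ‖v‖ ^ 2 * (2 * t)) t := fun t => by
    have h1 := (hΦ (x + t • v)).hasFDerivAt.comp_hasDerivAt t (hline t)
    rw [InnerProductSpace.toDual_apply_apply] at h1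
    have h2 := (hasDerivAt_id t).mul_const (inner ℝ (g x) v)
    have h3 := ((hasDerivAt_id t).pow 2).const_mul (ℓ / 2 * ‖v‖ ^ 2)
    refine ((h1.sub h2).sub h3).congr_deriv ?_
    simp
  have hanti : AntitoneOn φ (Set.Icc 0 1) := by
    refine antitoneOn_of_deriv_nonpos (convex_Icc 0 1)
      (fun t _ => (hderiv t).continuousAt.continuousWithinAt)
      (fun t _ => (hderiv t).differentiableAt.differentiableWithinAt) fun t ht => ?_
    rw [interior_Icc] at ht
    rw [(hderiv t).deriv, ← inner_sub_left]
    have h1 := real_inner_le_norm (g (x + t • v) - g x) v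
    have h2 := hg (x + t • v) x
    rw [add_sub_cancel_left, norm_smul, Real.norm_of_nonneg ht.1.le] at h2
    nlinarith [norm_nonneg v]
  have := hanti (Set.left_mem_Icc.2 zero_le_one) (Set.right_mem_Icc.2 zero_le_one) zero_le_one
  simp only [hφ, zero_smul, one_smul, add_zero, zero_mul, one_mul, sub_zero] at this
  norm_num at this
  linarith

/-- The error of an approximate hypergradient, in terms of the error in `y` and the error of the
linear solve. -/
theorem norm_approx_sub_hyperGrad_sq_le {n : ℕ} {F : E n → E n → ℝ} {LFx LFy LFy' : ℝ≥0}
    {CFy μ : ℝ} (hμ : 0 < μ) (hF : UpperAssumption F LFx LFy LFy' CFy) {B : E n →L[ℝ] E n}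
    (hB : ∀ x, ‖B x‖ ≤ 1 / μ * ‖x‖) (x y u : E n) :
    ‖gradX F x y + u - hyperGrad F B x‖ ^ 2
      ≤ 3 * c₂ μ LFx LFy * ‖y - B x‖ ^ 2 + 3 * ‖u - B (gradY F x y)‖ ^ 2 := by
  have h1 := (hF.gradX_lipschitz_y x).norm_sub_le y (B x)
  have h2 := (hF.gradY_lipschitz_y x).norm_sub_le y (B x)
  have h3 := (hB (gradY F x y - gradY F x (B x))).trans
    (mul_le_mul_of_nonneg_left h2 (by positivity))
  have hd : gradX F x y + u - hyperGrad F B x = (gradX F x y - gradX F x (B x))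
      + (u - B (gradY F x y)) + B (gradY F x y - gradY F x (B x)) := by
    simp only [hyperGrad, map_sub]
    abel
  have h4 := norm_add₃_le (a := gradX F x y - gradX F x (B x)) (b := u - B (gradY F x y))
    (c := B (gradY F x y - gradY F x (B x)))
  rw [← hd] at h4
  set a := ‖gradX F x y - gradX F x (B x)‖
  set b := ‖u - B (gradY F x y)‖
  set c := ‖B (gradY F x y - gradY F x (B x))‖
  have ha : a ^ 2 ≤ LFx ^ 2 * ‖y - B x‖ ^ 2 := by
    rw [← mul_pow]
    exact pow_le_pow_left₀ (norm_nonneg _) h1 2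
  have hc : c ^ 2 ≤ LFy ^ 2 / μ ^ 2 * ‖y - B x‖ ^ 2 := by
    have := pow_le_pow_left₀ (norm_nonneg _) h3 2
    refine this.trans (le_of_eq ?_)
    field_simp
  have h5 : ‖gradX F x y + u - hyperGrad F B x‖ ^ 2 ≤ (a + b + c) ^ 2 :=
    pow_le_pow_left₀ (norm_nonneg _) h4 2
  have h6 : (0 : ℝ) ≤ LFy ^ 2 / μ ^ 2 * ‖y - B x‖ ^ 2 := by positivity
  have h7 : 3 * c₂ μ LFx LFy * ‖y - B x‖ ^ 2 = 3 * (LFx ^ 2 * ‖y - B x‖ ^ 2)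
      + 6 * (LFy ^ 2 / μ ^ 2 * ‖y - B x‖ ^ 2) := by
    unfold c₂
    ring
  rw [h7]
  nlinarith [sq_nonneg (a - b), sq_nonneg (b - c), sq_nonneg (a - c)]

theorem norm_add_sq_le_young {n : ℕ} {ε : ℝ} (hε : 0 < ε) (a b : E n) :
    ‖a + b‖ ^ 2 ≤ (1 + ε) * ‖a‖ ^ 2 + (1 + 1 / ε) * ‖b‖ ^ 2 := by
  have h1 := pow_le_pow_left₀ (norm_nonneg _) (norm_add_le a b) 2
  have h2 : 0 ≤ (ε * ‖a‖ - ‖b‖) ^ 2 / ε := by positivity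
  have h3 : (1 + ε) * ‖a‖ ^ 2 + (1 + 1 / ε) * ‖b‖ ^ 2
      = (‖a‖ + ‖b‖) ^ 2 + (ε * ‖a‖ - ‖b‖) ^ 2 / ε := by
    field_simp
    ring
  linarith

/-- One inexact gradient step. -/
theorem inexact_descent {n : ℕ} {Φ : E n → ℝ} {g : E n → E n} (hΦ : ∀ x, HasGradientAt Φ (g x) x)
    {ℓ α : ℝ} (hℓ : 0 ≤ ℓ) (hα : 0 < α) (hg : ∀ x y, ‖g x - g y‖ ≤ ℓ * ‖x - y‖) (x w : E n) :
    Φ (x - α • w) ≤ Φ x - α * (1 / 2 - α * ℓ) * ‖g x‖ ^ 2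
      + α * (1 / 2 + α * ℓ) * ‖w - g x‖ ^ 2 := by
  have h1 := descent_lemma hΦ hg x (-(α • w))
  rw [← sub_eq_add_neg, norm_neg, norm_smul, mul_pow, Real.norm_eq_abs, sq_abs, inner_neg_right,
    inner_smul_right] at h1
  have h2 : ‖w‖ ^ 2 ≤ 2 * ‖g x‖ ^ 2 + 2 * ‖w - g x‖ ^ 2 := by
    have := norm_add_sq_le_young one_pos (g x) (w - g x)
    rw [add_sub_cancel] at this
    norm_num at this
    linarith
  have h3 : inner ℝ (g x) w = ‖g x‖ ^ 2 + inner ℝ (g x) (w - g x) := by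
    rw [inner_sub_right, real_inner_self_eq_norm_sq]
    ring
  have h4 : -inner ℝ (g x) (w - g x) ≤ 1 / 2 * ‖g x‖ ^ 2 + 1 / 2 * ‖w - g x‖ ^ 2 := by
    have := neg_le_of_abs_le (abs_real_inner_le_norm (g x) (w - g x))
    nlinarith [sq_nonneg (‖g x‖ - ‖w - g x‖)]
  have h5 : ℓ / 2 * (α ^ 2 * ‖w‖ ^ 2)
      ≤ ℓ / 2 * (α ^ 2 * (2 * ‖g x‖ ^ 2 + 2 * ‖w - g x‖ ^ 2)) := by gcongr
  rw [h3] at h1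
  have h6 := mul_le_mul_of_nonneg_left h4 hα.le
  linarith

/-! ### Summing the recursions -/

theorem sum_le_of_contraction {D p : ℕ → ℝ} {τ δ : ℝ} (hD : ∀ k, 0 ≤ D k) (hτ : τ < 1)
    (h0 : D 0 ≤ δ) (hstep : ∀ k, D (k + 1) ≤ τ * D k + p k) (K : ℕ) :
    ∑ k ∈ range K, D k ≤ (δ + ∑ k ∈ range K, p k) / (1 - τ) := by
  have h1 : ∑ k ∈ range (K + 1), D k
      ≤ δ + τ * ∑ k ∈ range K, D k + ∑ k ∈ range K, p k := by
    induction K with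
    | zero => simpa using h0
    | succ K ih =>
      have h2 := hstep K
      have h3 : τ * ∑ k ∈ range (K + 1), D k = τ * ∑ k ∈ range K, D k + τ * D K := by
        rw [sum_range_succ, mul_add]
      rw [sum_range_succ D (K + 1), sum_range_succ p K]
      linarith
  rw [le_div_iff₀ (by linarith)]
  rw [sum_range_succ] at h1
  linarith [hD K]

/-- `φ` are the objective values, `S` the squared gradient norms, `D` and `3 h` the two parts of the
squared error of the approximate gradients. -/
theorem sum_grad_le_of_recursion {φ S D h : ℕ → ℝ} {α ℓ τ ω δ inf : ℝ} (hα : 0 < α) (hℓ : 0 ≤ ℓ)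
    (hω : 0 ≤ ω) (hτ : τ < 1) (hδ : 0 ≤ δ)
    (hadm : α * ℓ + ω * α ^ 2 * (1 / 2 + α * ℓ) * (1 / (1 - τ)) ≤ 1 / 4)
    (hS : ∀ k, 0 ≤ S k) (hD : ∀ k, 0 ≤ D k) (hh : ∀ k, 0 ≤ h k)
    (hinf : ∀ k, inf ≤ φ k)
    (hφ : ∀ k, φ (k + 1) ≤ φ k - α * (1 / 2 - α * ℓ) * S k
      + α * (1 / 2 + α * ℓ) * (D k + 3 * h k))
    (hD0 : D 0 ≤ δ) (hDs : ∀ k, D (k + 1) ≤ τ * D k + ω * α ^ 2 * (S k + 3 * h k)) (K : ℕ) :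
    ∑ k ∈ range K, S k
      ≤ 4 * (φ 0 - inf) / α + 3 * δ / (1 - τ) + 9 * ∑ k ∈ range K, h k := by
  have hτ' : 0 < 1 - τ := by linarith
  have hsumφ : φ K ≤ φ 0 - α * (1 / 2 - α * ℓ) * ∑ k ∈ range K, S k
      + α * (1 / 2 + α * ℓ) * (∑ k ∈ range K, D k + 3 * ∑ k ∈ range K, h k) := by
    induction K with
    | zero => simp
    | succ K ih =>
      rw [sum_range_succ, sum_range_succ, sum_range_succ]
      have := hφ K
      linarith
  have hsumD := sum_le_of_contraction hD hτ hD0 hDs K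
  rw [← mul_sum, sum_add_distrib, ← mul_sum] at hsumD
  have hX : 0 ≤ ∑ k ∈ range K, S k := sum_nonneg fun k _ => hS k
  have hN : 0 ≤ ∑ k ∈ range K, h k := sum_nonneg fun k _ => hh k
  set X := ∑ k ∈ range K, S k
  set N := ∑ k ∈ range K, h k
  set Y := ∑ k ∈ range K, D k
  set a := α * ℓ with ha
  have ha0 : 0 ≤ a := by positivity
  set b := ω * α ^ 2 * (1 / (1 - τ)) with hb
  have hb0 : 0 ≤ b := by positivity
  have hadm' : a + b * (1 / 2 + a) ≤ 1 / 4 := by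
    refine le_trans (le_of_eq ?_) hadm
    rw [hb]
    ring
  have hY : Y ≤ δ / (1 - τ) + b * (X + 3 * N) := by
    refine hsumD.trans (le_of_eq ?_)
    rw [hb]
    ring
  set d := δ / (1 - τ) with hd
  have hd0 : 0 ≤ d := by positivity
  have hb2 : 0 ≤ b * (1 / 2 + a) := by positivity
  have h1 : α * ((1 / 2 - a) * X) ≤ (φ 0 - inf) + α * ((1 / 2 + a) * (Y + 3 * N)) := by
    linarith [hinf K]
  have h2 : (1 / 2 - a) * X ≤ (φ 0 - inf) / α + (1 / 2 + a) * (Y + 3 * N) := by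
    have : (φ 0 - inf) / α * α = φ 0 - inf := div_mul_cancel₀ _ hα.ne'
    refine le_of_mul_le_mul_left ?_ hα
    linarith
  have h3 : (1 / 2 + a) * (Y + 3 * N) ≤ (1 / 2 + a) * (d + b * (X + 3 * N) + 3 * N) := by
    gcongr
  have h4 : (1 / 2 + a) * d ≤ 3 / 4 * d := by gcongr; linarith
  have h5 : (1 / 2 + a + b * (1 / 2 + a)) * (3 * N) ≤ 3 / 4 * (3 * N) := by gcongr; linarith
  have h6 : 1 / 4 * X ≤ (1 / 2 - a - b * (1 / 2 + a)) * X := by gcongr; linarith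
  have h7 : 4 * (φ 0 - inf) / α = 4 * ((φ 0 - inf) / α) := by ring
  have h8 : 3 * δ / (1 - τ) = 3 * d := by rw [hd]; ring
  rw [h7, h8]
  linarith

/-- `∑_{k < K} h_k ≤ U (1/4 + ln K)` if `h_0 ≤ U / 4` and `h_k ≤ U / (k + 1)`. -/
theorem sum_le_log {h : ℕ → ℝ} {U : ℝ} (hU : 0 ≤ U) (h0 : h 0 ≤ U / 4)
    (hk : ∀ k, 1 ≤ k → h k ≤ U / (k + 1)) {K : ℕ} (hK : 1 ≤ K) :
    ∑ k ∈ range K, h k ≤ U * (1 / 4 + Real.log K) := by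
  induction K, hK using Nat.le_induction with
  | base => simp; linarith
  | succ K hK ih =>
    have hKpos : (0 : ℝ) < K := by exact_mod_cast hK
    rw [sum_range_succ]
    have h1 := Real.one_sub_inv_le_log_of_pos (x := ((K : ℝ) + 1) / K) (by positivity)
    rw [Real.log_div (by positivity) hKpos.ne'] at h1
    have h2 : 1 - (((K : ℝ) + 1) / K)⁻¹ = 1 / (K + 1) := by
      field_simp
      ring
    rw [h2] at h1
    have h3 := mul_le_mul_of_nonneg_left h1 hU
    have h4 := hk K hK
    have h5 : U * (1 / ((K : ℝ) + 1)) = U / (K + 1) := by ring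
    push_cast
    linarith

/-! ### Admissible parameters -/

theorem HessianBounds.le {n : ℕ} {μ L : ℝ} {A : E n →L[ℝ] E n} (h : HessianBounds μ L A)
    (hn : n ≠ 0) : μ ≤ L := by
  have : NeZero n := ⟨hn⟩
  have h1 := (h.lower (EuclideanSpace.basisFun (Fin n) ℝ 0)).trans (h.upper _)
  simpa using h1

theorem tb_nonneg {n : ℕ} {μ L : ℝ} (hμ : 0 < μ) (hμL : n ≠ 0 → μ ≤ L) : 0 ≤ tb n μ L := by
  rcases eq_or_ne n 0 with rfl | hn
  · simp [tb]
  · have := Real.log_nonneg ((one_le_div hμ).2 (hμL hn))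
    unfold tb
    positivity

theorem rate_nonneg {n : ℕ} {μ L : ℝ} (hμ : 0 < μ) (hμL : n ≠ 0 → μ ≤ L) {T : ℕ} (hT : 0 < T) :
    0 ≤ rate n μ L T := by
  rcases eq_or_ne n 0 with rfl | hn
  · rw [rate, ct_sq (by simp [tb])]
    simp [tb, hT.ne']
  · have : 0 ≤ L := hμ.le.trans (hμL hn)
    unfold rate
    positivity

theorem tendsto_rate {n : ℕ} {μ L : ℝ} (htb : 0 ≤ tb n μ L) :
    Filter.Tendsto (fun T => rate n μ L T) Filter.atTop (nhds 0) := by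
  have h1 : Filter.Tendsto (fun T : ℕ => tb n μ L ^ T * (1 / (T : ℝ)) ^ T) Filter.atTop
      (nhds 0) := by
    refine squeeze_zero (fun T => by positivity) (fun T => ?_)
      (FloorSemiring.tendsto_pow_div_factorial_atTop (tb n μ L))
    have h : (T.factorial : ℝ) ≤ (T : ℝ) ^ T := by exact_mod_cast T.factorial_le_pow
    rw [one_div, inv_pow, div_eq_mul_inv]
    exact mul_le_mul_of_nonneg_left (inv_anti₀ (by positivity) h) (by positivity)
  have h2 := h1.const_mul (4 * (L / μ) ^ 3)
  rw [mul_zero] at h2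
  refine h2.congr fun T => ?_
  rw [rate, ct_sq htb]
  ring

theorem exists_admissible {n : ℕ} {μ L : ℝ} (hμ : 0 < μ) (htb : 0 ≤ tb n μ L)
    (LFx LFy LFy' : ℝ≥0) :
    ∃ (α ε : ℝ) (T : ℕ), Admissible n μ L LFx LFy LFy' α ε T := by
  have hℓ := LPhi_nonneg hμ LFx LFy LFy'
  set ℓ := LPhi μ LFx LFy LFy' with hℓdef
  set α : ℝ := 1 / (8 * (ℓ + 1)) with hα
  have hα0 : 0 < α := by positivity
  have hαℓ : α * ℓ < 1 / 4 := by
    rw [hα, div_mul_eq_mul_div, one_mul, div_lt_iff₀ (by positivity)]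
    linarith
  have hr := tendsto_rate htb
  have hτ : Filter.Tendsto (fun T => tau n μ L LFx LFy α 1 T) Filter.atTop (nhds 0) := by
    have := hr.mul_const ((1 + 1) + (1 + 1 / 1) * α ^ 2 * c₁ μ LFx LFy)
    rwa [zero_mul] at this
  have hω : Filter.Tendsto (fun T => omega n μ L LFx LFy 1 T) Filter.atTop (nhds 0) := by
    have := hr.const_mul (c₁ μ LFx LFy * (1 + 1 / 1))
    rwa [mul_zero] at this
  have hsum : Filter.Tendsto (fun T => α * ℓ + omega n μ L LFx LFy 1 T * α ^ 2 * (1 / 2 + α * ℓ) *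
      (1 / (1 - tau n μ L LFx LFy α 1 T))) Filter.atTop (nhds (α * ℓ)) := by
    have h1 : Filter.Tendsto (fun T => 1 / (1 - tau n μ L LFx LFy α 1 T)) Filter.atTop
        (nhds (1 / (1 - 0))) := tendsto_const_nhds.div (hτ.const_sub 1) (by norm_num)
    have h2 := ((((hω.mul_const (α ^ 2)).mul_const (1 / 2 + α * ℓ)).mul h1).const_add (α * ℓ))
    simpa using h2
  obtain ⟨T, h1, h2, h3, h4⟩ := ((hτ.eventually_lt_const one_pos).and
    ((hsum.eventually_lt_const hαℓ).and ((Filter.eventually_gt_atTop 0).and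
      (tendsto_natCast_atTop_atTop.eventually_ge_atTop (tb n μ L))))).exists
  exact ⟨α, 1, T, hα0, one_pos, h3, h4, h1, h2.le⟩

/-! ### The convergence estimate -/

theorem c₂_nonneg (μ : ℝ) (a b : ℝ) : 0 ≤ c₂ μ a b := by
  unfold c₂
  positivity

theorem c₁_nonneg (μ : ℝ) (a b : ℝ) : 0 ≤ c₁ μ a b := by
  have := c₂_nonneg μ a b
  unfold c₁
  positivity

/-- The convergence estimate multiplied by `K`, for `n ≥ 1`, with `Φ(x) = F(x, B x)` and
`B = A⁻¹`. -/
theorem sum_norm_hyperGrad_sq_le {n : ℕ} (hn : n ≠ 0) {A : Matrix (Fin n) (Fin n) ℝ} {μ L : ℝ}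
    (hμ : 0 < μ) (h : HessianBounds μ L (op A)) {S : E n →L[ℝ] E n}
    (hS : ∀ x y, inner ℝ (S x) y = inner ℝ x (S y)) (hSA : S ∘L S = op A)
    {B : E n →L[ℝ] E n} (hAB : ∀ x, op A (B x) = x)
    (hBs : ∀ x y, inner ℝ (B x) y = inner ℝ x (B y)) (hB : ∀ x, ‖B x‖ ≤ 1 / μ * ‖x‖)
    {F : E n → E n → ℝ} {LFx LFy LFy' : ℝ≥0} {CFy : ℝ} (hF : UpperAssumption F LFx LFy LFy' CFy)
    (hΦ : BddBelow (Set.range fun x => F x (B x))) {α ε : ℝ} {T : ℕ}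
    (hadm : Admissible n μ L LFx LFy LFy' α ε T) (β : ℝ) {ξ : ℕ → ℕ → ℝ}
    (hξ : ∀ k i, 0 < ξ k i) (x₀ y₀ : E n) {K : ℕ} (hK : 1 ≤ K) :
    ∑ k ∈ range K, ‖hyperGrad F B (xIter F A L α β T ξ x₀ y₀ k)‖ ^ 2
      ≤ 4 * (F x₀ (B x₀) - ⨅ x, F x (B x)) / α
        + 3 * delta₀ A μ L LFx LFy T x₀ y₀ / (1 - tau n μ L LFx LFy α ε T)
        + 18 * (n * L * CFy ^ 2 / μ ^ 3) * Real.log K := by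
  obtain ⟨hα, hε, hT, hTb, hτ, hadm⟩ := hadm
  have hμL := h.le hn
  have hL : 0 < L := hμ.trans_le hμL
  have hn1 : (1 : ℝ) ≤ n := by exact_mod_cast Nat.one_le_iff_ne_zero.2 hn
  have hκ1 : 1 ≤ L / μ := (one_le_div hμ).2 hμL
  have hℓ := LPhi_nonneg hμ LFx LFy LFy'
  have hc₂ := c₂_nonneg μ LFx LFy
  have hc₁ := c₁_nonneg μ LFx LFy
  have hr := rate_nonneg hμ h.le hT
  have hgrad : ∀ x, HasGradientAt (fun x => F x (B x)) (hyperGrad F B x) x :=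
    hasGradientAt_comp_linear hF.differentiable hBs
  have hlip := norm_hyperGrad_sub_le hμ hF hB
  have hinf : ∀ x, ⨅ x, F x (B x) ≤ F x (B x) := fun x => ciInf_le hΦ x
  have hlow := lowerSol_quadLower h hμ hAB
  have hω : 0 ≤ omega n μ L LFx LFy ε T := by
    unfold omega
    positivity
  set U := n * L * CFy ^ 2 / μ ^ 3 with hU
  have hU0 : 0 ≤ U := by positivity
  have hδ : 0 ≤ delta₀ A μ L LFx LFy T x₀ y₀ := by
    unfold delta₀
    positivity
  set ℓ := LPhi μ LFx LFy LFy' with hℓdef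
  set τ := tau n μ L LFx LFy α ε T with hτdef
  set ω := omega n μ L LFx LFy ε T with hωdef
  set δ := delta₀ A μ L LFx LFy T x₀ y₀ with hδdef
  have hτ' : 0 < 1 - τ := by linarith
  have hdiv : 0 ≤ 3 * δ / (1 - τ) := by positivity
  rcases hK.eq_or_lt with rfl | hK
  · -- For `K = 1` the right-hand side has no term for the error of the linear solve, but
    -- an exact gradient step from `x₀` already bounds `‖∇Φ(x₀)‖²`.
    have h1 := descent_lemma hgrad hlip x₀ (-(α • hyperGrad F B x₀))
    rw [norm_neg, norm_smul, mul_pow, Real.norm_eq_abs, sq_abs, inner_neg_right,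
      inner_smul_right, real_inner_self_eq_norm_sq] at h1
    have h2 := hinf (x₀ + -(α • hyperGrad F B x₀))
    have h3 : α * ℓ ≤ 1 / 4 := by
      have : 0 ≤ ω * α ^ 2 * (1 / 2 + α * ℓ) * (1 / (1 - τ)) := by positivity
      linarith
    have h4 : α * ℓ * (α * ‖hyperGrad F B x₀‖ ^ 2) ≤ 1 / 4 * (α * ‖hyperGrad F B x₀‖ ^ 2) := by
      gcongr
    have h5 : ‖hyperGrad F B x₀‖ ^ 2 ≤ 4 * (F x₀ (B x₀) - ⨅ x, F x (B x)) / α := by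
      rw [le_div_iff₀ hα]
      have : 0 ≤ α * ‖hyperGrad F B x₀‖ ^ 2 := by positivity
      linarith
    simpa [xIter, iter] using h5.trans (le_add_of_nonneg_right hdiv)
  set H₀ : E n →L[ℝ] E n := L⁻¹ • ContinuousLinearMap.id ℝ (E n) with hH₀
  set w := iter F (quadLower A) H₀ α β 1 0 T (fun j => j + 1) ξ x₀ y₀ with hw
  set a : ℕ → E n × (E n →L[ℝ] E n) :=
    fun k => subA (quadLower A) H₀ β 1 0 T (w k).1 (w k).2 with ha
  set d : ℕ → E n := fun k => gradY F (w k).1 (a k).1 with hd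
  set u : ℕ → E n := fun k =>
    if k + 1 = 1 then (a k).2 (d k) else subB (quadLower A) H₀ (ξ k) (w k).1 (a k).1 (d k) (k + 1)
    with hu
  set g : ℕ → E n := fun k => gradX F (w k).1 (a k).1 + u k with hg
  have hwx : ∀ k, (w (k + 1)).1 = (w k).1 - α • g k := by
    intro k
    have : (w (k + 1)).1 = (w k).1 - α • (gradX F (w k).1 (a k).1
        - (jacXY (quadLower A) (w k).1 (a k).1).adjoint (u k)) := rfl
    rw [this, jacXY_quadLower h.symm, map_neg]
    simp [hg, ContinuousLinearMap.adjoint_id]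
  have hwy : ∀ k, (w (k + 1)).2 = (a k).1 := fun k => rfl
  set hh : ℕ → ℝ := fun k => ‖u k - B (d k)‖ ^ 2 with hhdef
  set D : ℕ → ℝ := fun k => 3 * c₂ μ LFx LFy * ‖(a k).1 - B (w k).1‖ ^ 2 with hDdef
  have herr : ∀ k, ‖g k - hyperGrad F B (w k).1‖ ^ 2 ≤ D k + 3 * hh k := fun k =>
    norm_approx_sub_hyperGrad_sq_le hμ hF hB (w k).1 (a k).1 (u k)
  have hinner : ∀ k, ‖(a k).1 - B (w k).1‖ ^ 2
      ≤ rate n μ L T * ‖(w k).2 - B (w k).1‖ ^ 2 := fun k =>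
    norm_subA_sub_sq_le hμ hμL h hS hSA β (w k).1 (w k).2 _ (hAB _) hT hTb
  have hD0 : D 0 ≤ δ := by
    have := mul_le_mul_of_nonneg_left (hinner 0) (by positivity : 0 ≤ 3 * c₂ μ LFx LFy)
    refine this.trans (le_of_eq ?_)
    rw [hδdef, delta₀, hlow, norm_sub_rev]
    simp only [hw, iter]
    ring
  have hDs : ∀ k, D (k + 1) ≤ τ * D k
      + ω * α ^ 2 * (‖hyperGrad F B (w k).1‖ ^ 2 + 3 * hh k) := by
    intro k
    have h1 := hinner (k + 1)
    have h2 := norm_add_sq_le_young hε ((a k).1 - B (w k).1) (B (w k).1 - B (w (k + 1)).1)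
    rw [sub_add_sub_cancel] at h2
    rw [hwy] at h1
    have h3 : ‖B (w k).1 - B (w (k + 1)).1‖ ^ 2 ≤ (1 / μ) ^ 2 * (α ^ 2 * ‖g k‖ ^ 2) := by
      rw [← map_sub, hwx, sub_sub_cancel]
      refine (pow_le_pow_left₀ (norm_nonneg _) (hB _) 2).trans (le_of_eq ?_)
      rw [norm_smul, Real.norm_eq_abs, mul_pow, mul_pow, sq_abs]
    have h4 : ‖g k‖ ^ 2 ≤ 2 * ‖hyperGrad F B (w k).1‖ ^ 2 + 2 * (D k + 3 * hh k) := by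
      have := norm_add_sq_le_young one_pos (hyperGrad F B (w k).1) (g k - hyperGrad F B (w k).1)
      rw [add_sub_cancel] at this
      norm_num at this
      linarith [herr k]
    have h5 : ‖(a (k + 1)).1 - B (w (k + 1)).1‖ ^ 2 ≤ rate n μ L T *
        ((1 + ε) * ‖(a k).1 - B (w k).1‖ ^ 2 + (1 + 1 / ε) * ((1 / μ) ^ 2 * (α ^ 2 *
          (2 * ‖hyperGrad F B (w k).1‖ ^ 2 + 2 * (D k + 3 * hh k))))) := by
      refine h1.trans ?_
      gcongr
      refine h2.trans ?_
      gcongr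
      refine h3.trans ?_
      gcongr
    have h6 := mul_le_mul_of_nonneg_left h5 (by positivity : 0 ≤ 3 * c₂ μ LFx LFy)
    refine h6.trans (le_of_eq ?_)
    simp only [hτdef, hωdef, tau, omega, c₁, hDdef]
    ring
  have hdC : ∀ k, ‖d k‖ ^ 2 / μ ^ 2 ≤ CFy ^ 2 / μ ^ 2 := fun k => by
    have := pow_le_pow_left₀ (norm_nonneg _) (hF.gradY_bound (w k).1 (a k).1) 2
    gcongr
  have hh0 : hh 0 ≤ U / 4 := by
    have h1 := norm_subA_matrix_sub_sq_le hμ hμL h hS hSA hAB hB β (w 0).1 (w 0).2 (d 0) T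
    have h2 : hh 0 = ‖(a 0).2 (d 0) - B (d 0)‖ ^ 2 := by simp [hhdef, hu]
    have h3 : 1 - μ / L ≤ n * (L / μ) / 4 := by
      have h4 : 1 - μ / L ≤ L / μ / 4 := by
        rw [div_div, one_sub_div hL.ne', div_le_div_iff₀ hL (by positivity)]
        nlinarith [sq_nonneg (L - 2 * μ)]
      have h5 : L / μ ≤ n * (L / μ) := le_mul_of_one_le_left (by positivity) hn1
      linarith
    rw [h2]
    refine h1.trans ((mul_le_mul h3 (hdC 0) (by positivity) (by positivity)).trans (le_of_eq ?_))
    rw [hU]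
    field_simp
  have hhk : ∀ k : ℕ, 1 ≤ k → hh k ≤ U / (k + 1) := by
    intro k hk
    have h1 := norm_subB_sub_sq_le hμ hμL h hS hSA hAB hB (hξ k) (w k).1 (a k).1 (d k) k
    have h2 : hh k = ‖subB (quadLower A) H₀ (ξ k) (w k).1 (a k).1 (d k) (k + 1) - B (d k)‖ ^ 2 := by
      simp [hhdef, hu, show k ≠ 0 by omega]
    rw [h2]
    have h3 : (n : ℝ) * (L / μ - 1) / (k + 1) ≤ n * (L / μ) / (k + 1) := by
      gcongr
      linarith
    refine h1.trans ((mul_le_mul h3 (hdC k) (by positivity) (by positivity)).trans (le_of_eq ?_))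
    rw [hU]
    field_simp
  have hφ : ∀ k, F (w (k + 1)).1 (B (w (k + 1)).1) ≤ F (w k).1 (B (w k).1)
      - α * (1 / 2 - α * ℓ) * ‖hyperGrad F B (w k).1‖ ^ 2
      + α * (1 / 2 + α * ℓ) * (D k + 3 * hh k) := by
    intro k
    have h1 := inexact_descent hgrad hℓ hα hlip (w k).1 (g k)
    rw [← hwx] at h1
    have h2 := mul_le_mul_of_nonneg_left (herr k) (by positivity : 0 ≤ α * (1 / 2 + α * ℓ))
    linarith
  have hmain := sum_grad_le_of_recursion (φ := fun k => F (w k).1 (B (w k).1))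
    (S := fun k => ‖hyperGrad F B (w k).1‖ ^ 2) (D := D) (h := hh) hα hℓ hω hτ hδ hadm
    (fun k => by positivity) (fun k => by positivity) (fun k => by positivity)
    (fun k => hinf _) hφ hD0 hDs K
  have hlog := sum_le_log hU0 hh0 hhk (by omega : 1 ≤ K)
  -- For `K ≥ 2` the first linear solve is absorbed: `9 (1/4 + ln K) ≤ 18 ln K`.
  have hlog2 : 1 / 4 ≤ Real.log K := by
    have h1 : Real.log 2 ≤ Real.log K :=
      Real.log_le_log (by norm_num) (by exact_mod_cast hK)
    linarith [Real.log_two_gt_d9]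
  have h1 : U * (1 / 4 + Real.log K) ≤ U * (2 * Real.log K) := by
    gcongr
    linarith
  have h2 : ∑ k ∈ range K, ‖hyperGrad F B (xIter F A L α β T ξ x₀ y₀ k)‖ ^ 2
      = ∑ k ∈ range K, ‖hyperGrad F B (w k).1‖ ^ 2 := rfl
  have h3 : F (w 0).1 (B (w 0).1) = F x₀ (B x₀) := rfl
  rw [h2]
  simp only [h3] at hmain
  linarith

theorem isBigO_log_div {f : ℕ → ℝ} (hf : ∀ K, 0 ≤ f K) {a c : ℝ} (ha : 0 ≤ a)
    (h : ∀ K : ℕ, 1 ≤ K → f K ≤ (a + c * Real.log K) / K) :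
    f =O[Filter.atTop] (fun K : ℕ => Real.log K / K) := by
  refine Asymptotics.IsBigO.of_bound (2 * a + c) ?_
  filter_upwards [Filter.eventually_ge_atTop 2] with K hK
  have hlog2 : 1 / 2 ≤ Real.log K := by
    have h1 : Real.log 2 ≤ Real.log K :=
      Real.log_le_log (by norm_num) (by exact_mod_cast hK)
    linarith [Real.log_two_gt_d9]
  have hKpos : (0 : ℝ) < K := by exact_mod_cast (by omega : 0 < K)
  rw [Real.norm_of_nonneg (hf K), Real.norm_of_nonneg (by positivity), ← mul_div_assoc]
  refine (h K (by omega)).trans ?_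
  gcongr
  nlinarith

end QNBO

theorem theorem1 (n : ℕ) (A : Matrix (Fin n) (Fin n) ℝ) (μ L : ℝ) (hμ : 0 < μ)
    (hμA : (A - μ • (1 : Matrix (Fin n) (Fin n) ℝ)).PosSemidef)
    (hAL : (L • (1 : Matrix (Fin n) (Fin n) ℝ) - A).PosSemidef)
    (F : QNBO.E n → QNBO.E n → ℝ) (LFx LFy LFy' : ℝ≥0) (CFy : ℝ)
    (hF : QNBO.UpperAssumption F LFx LFy LFy' CFy)
    (hΦ : BddBelow (Set.range (QNBO.bilevelObj F (QNBO.quadLower A)))) :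
    Differentiable ℝ (QNBO.bilevelObj F (QNBO.quadLower A)) ∧
    (∃ (α ε : ℝ) (T : ℕ), QNBO.Admissible n μ L LFx LFy LFy' α ε T) ∧
    ∀ (α ε : ℝ) (T : ℕ), QNBO.Admissible n μ L LFx LFy LFy' α ε T →
      ∀ (β : ℝ) (ξ : ℕ → ℕ → ℝ), (∀ k i, 0 < ξ k i) → ∀ x₀ y₀ : QNBO.E n,
        (∀ K : ℕ, 1 ≤ K →
          (1 / (K : ℝ)) * ∑ k ∈ Finset.range K,
              ‖gradient (QNBO.bilevelObj F (QNBO.quadLower A))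
                (QNBO.xIter F A L α β T ξ x₀ y₀ k)‖ ^ 2
            ≤ 4 * (QNBO.bilevelObj F (QNBO.quadLower A) x₀
                  - ⨅ x, QNBO.bilevelObj F (QNBO.quadLower A) x) / (α * K)
              + 3 * QNBO.delta₀ A μ L LFx LFy T x₀ y₀ /
                  (K * (1 - QNBO.tau n μ L LFx LFy α ε T))
              + 18 * n * L * CFy ^ 2 * Real.log K / (μ ^ 3 * K)) ∧
        (fun K : ℕ => (1 / (K : ℝ)) * ∑ k ∈ Finset.range K,
            ‖gradient (QNBO.bilevelObj F (QNBO.quadLower A))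
              (QNBO.xIter F A L α β T ξ x₀ y₀ k)‖ ^ 2)
          =O[Filter.atTop] (fun K : ℕ => Real.log K / K) := by
  have h := QNBO.HessianBounds.of_posSemidef hμA hAL
  have hApos : A.PosSemidef := by
    have := hμA.add (Matrix.PosSemidef.one.smul hμ.le)
    simpa using this
  obtain ⟨S, hS, hSA⟩ := QNBO.exists_symm_sqrt hApos
  obtain ⟨B, hAB, hBs, hB⟩ := h.exists_inverse hμ
  have hobj : QNBO.bilevelObj F (QNBO.quadLower A) = fun x => F x (B x) := by
    funext x
    rw [QNBO.bilevelObj, QNBO.lowerSol_quadLower h hμ hAB]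
  have hgrad := QNBO.hasGradientAt_comp_linear hF.differentiable hBs
  have hgrad' : ∀ x, gradient (fun x => F x (B x)) x = QNBO.hyperGrad F B x :=
    fun x => (hgrad x).gradient
  have htb := QNBO.tb_nonneg hμ h.le
  rw [hobj] at hΦ ⊢
  refine ⟨fun x => (hgrad x).differentiableAt, QNBO.exists_admissible hμ htb LFx LFy LFy', ?_⟩
  intro α ε T hadm β ξ hξ x₀ y₀
  simp only [hgrad']
  have hα : 0 < α := hadm.1
  have hτ : 0 < 1 - QNBO.tau n μ L LFx LFy α ε T := sub_pos.2 hadm.2.2.2.2.1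
  have hgap : 0 ≤ F x₀ (B x₀) - ⨅ x, F x (B x) := sub_nonneg.2 (ciInf_le hΦ x₀)
  have hδ : 0 ≤ QNBO.delta₀ A μ L LFx LFy T x₀ y₀ := by
    have := QNBO.rate_nonneg hμ h.le hadm.2.2.1
    have := QNBO.c₂_nonneg μ LFx LFy
    unfold QNBO.delta₀
    positivity
  have hsum : ∀ K : ℕ, 1 ≤ K →
      ∑ k ∈ Finset.range K, ‖QNBO.hyperGrad F B (QNBO.xIter F A L α β T ξ x₀ y₀ k)‖ ^ 2
        ≤ 4 * (F x₀ (B x₀) - ⨅ x, F x (B x)) / α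
          + 3 * QNBO.delta₀ A μ L LFx LFy T x₀ y₀ / (1 - QNBO.tau n μ L LFx LFy α ε T)
          + 18 * (n * L * CFy ^ 2 / μ ^ 3) * Real.log K := by
    intro K hK
    -- For `n = 0` nothing is known about the sign of `L`, but all norms vanish.
    rcases eq_or_ne n 0 with rfl | hn
    · have h0 : ∀ v : QNBO.E 0, ‖v‖ = 0 := fun v => by
        rw [Subsingleton.elim v 0, norm_zero]
      have h1 : 0 ≤ 4 * (F x₀ (B x₀) - ⨅ x, F x (B x)) / α := by positivity
      have h2 : 0 ≤ 3 * QNBO.delta₀ A μ L LFx LFy T x₀ y₀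
        / (1 - QNBO.tau 0 μ L LFx LFy α ε T) := by positivity
      simpa [h0] using add_nonneg h1 h2
    · exact QNBO.sum_norm_hyperGrad_sq_le hn hμ h hS hSA hAB hBs hB hF hΦ hadm β hξ x₀ y₀ hK
  have hmean : ∀ K : ℕ, 1 ≤ K → (1 / (K : ℝ)) *
      ∑ k ∈ Finset.range K, ‖QNBO.hyperGrad F B (QNBO.xIter F A L α β T ξ x₀ y₀ k)‖ ^ 2
        ≤ (4 * (F x₀ (B x₀) - ⨅ x, F x (B x)) / α
          + 3 * QNBO.delta₀ A μ L LFx LFy T x₀ y₀ / (1 - QNBO.tau n μ L LFx LFy α ε T)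
          + 18 * (n * L * CFy ^ 2 / μ ^ 3) * Real.log K) / K := fun K hK => by
    rw [one_div_mul_eq_div]
    exact div_le_div_of_nonneg_right (hsum K hK) (Nat.cast_nonneg K)
  refine ⟨fun K hK => (hmean K hK).trans (le_of_eq ?_),
    QNBO.isBigO_log_div (fun K => by positivity) (by positivity) hmean⟩
  have hKpos : (0 : ℝ) < K := by exact_mod_cast hK
  field_simp
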